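/- For $n\ge 1$ write $[n]=\{1,\dots,n\}$ and $\|x\|=\bigl(\frac1n\sum_{i=1}^n x_i^2\bigr)^{1/2}$ for $x\in\mathbb R^n$. Let $A_n=(a_{ij})_{i,j\in[n]}$ be a random symmetric matrix with $a_{ii}=0$ whose entries $a_{ij}$, $i<j$, are i.i.d. standard Gaussian, and let $u=u^n$ be a random vector in $\mathbb R^n$, independent of $A_n$, with $\|u^n\|\le 1$. Let $(f_k)_{k\ge 0}$ be smooth bounded functions $\mathbb R\to\mathbb R$ with bounded derivatives of all orders. The AMP iteration is defined by $u^{[0]}=u$, $u^{[1]}_i=\frac1{\sqrt n}\sum_{j=1}^n a_{ij}f_0(u_j)$ and, for $k\ge 1$, $$u^{[k+1]}_i=\frac1{\sqrt n}\sum_{j=1}^n a_{ij}f_k(u^{[k]}_j)-\Bigl(\frac1n\sum_{j=1}^n f_k'(u^{[k]}_j)\Bigr)f_{k-1}(u_i^{[k-1]}),\qquad i\in[n].$$ The cavity iteration is defined, for $S\subseteq[n]$ with $|S|\le n-1$ and $i\in[n]\setminus S$, by $w^{[0]}_{S,i}=u_i$ and, for $0\le k\le n-2$, $S\subseteq[n]$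 with $|S|\le n-(k+2)$ and $i\in[n]\setminus S$, by $$w^{[k+1]}_{S,i}=\frac1{\sqrt n}\sum_{j\notin S\cup\{i\}}a_{ij}f_k\bigl(w^{[k]}_{S\cup\{i\},j}\bigr);$$ write $w^{[k]}=(w^{[k]}_{\emptyset,i})_{i\in[n]}$ for $0\le k\le n-1$. Then for every $k\ge 0$ there is a constant $C_k>0$ (independent of $n$) such that for all $n\ge k+1$, $$\mathbb E\bigl\|u^{[k]}-w^{[k]}\bigr\|^2\le \frac{C_k}{n}.$$ -/

import Mathlib

namespace CavityAMP

/-- The normalized Euclidean norm `‖x‖ = (n⁻¹ ∑ᵢ xᵢ²)^{1/2}` on `ℝⁿ`. -/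
noncomputable def rmsNorm {n : ℕ} (x : Fin n → ℝ) : ℝ :=
  Real.sqrt ((∑ i, x i ^ 2) / n)

/-- A smooth real function which is bounded together with all its derivatives
(the case `m = 0` is the boundedness of `g` itself). -/
def SmoothBounded (g : ℝ → ℝ) : Prop :=
  ContDiff ℝ ((⊤ : ℕ∞) : WithTop ℕ∞) g ∧ ∀ m : ℕ, ∃ M : ℝ, ∀ x : ℝ, |iteratedDeriv m g x| ≤ M

/-- The cavity (self-avoiding path) iteration `w_{S,i}^{[k]}`. It is meant for `i ∉ S` and
`|S| + k + 1 ≤ n`; the recursion started at such a triple `(k, S, i)` only visits such triples. -/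
noncomputable def cavity {n : ℕ} (f : ℕ → ℝ → ℝ) (A : Fin n → Fin n → ℝ) (u : Fin n → ℝ) :
    ℕ → Finset (Fin n) → Fin n → ℝ
  | 0, _, i => u i
  | k + 1, S, i =>
      1 / Real.sqrt n *
        ∑ j ∈ Finset.univ \ (S ∪ {i}), A i j * f k (cavity f A u k (S ∪ {i}) j)

/-- The approximate message passing iteration `u^{[k]}`. -/
noncomputable def amp {n : ℕ} (f : ℕ → ℝ → ℝ) (A : Fin n → Fin n → ℝ) (u : Fin n → ℝ) :
    ℕ → Fin n → ℝ
  | 0 => u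
  | 1 => fun i => 1 / Real.sqrt n * ∑ j, A i j * f 0 (u j)
  | k + 2 => fun i =>
      1 / Real.sqrt n * ∑ j, A i j * f (k + 1) (amp f A u (k + 1) j)
        - (1 / n * ∑ j, deriv (f (k + 1)) (amp f A u (k + 1) j)) * f k (amp f A u k i)

open MeasureTheory ProbabilityTheory in
/-- `A` is a random symmetric `n × n` matrix with zero diagonal whose entries above the diagonal
are i.i.d. standard Gaussian. -/
structure IsGaussianDisorder {Ω : Type*} [MeasurableSpace Ω] {n : ℕ} (P : Measure Ω)
    (A : Ω → Fin n → Fin n → ℝ) : Prop where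
  measurable : Measurable A
  symm : ∀ ω i j, A ω i j = A ω j i
  diag : ∀ ω i, A ω i i = 0
  law : ∀ i j, i < j → P.map (fun ω => A ω i j) = gaussianReal 0 1
  indep : iIndepFun (fun (e : {e : Fin n × Fin n // e.1 < e.2}) ω => A ω e.1.1 e.1.2) P

end CavityAMP

/-!
The cavity iteration `w` is compared with the AMP iteration `u` by showing that `w` satisfies the
AMP recursion up to a defect of mean square `O(1/n)` in each coordinate, and that the recursion is
stable.

*Defect.* Fix `i` and write `w⁰_j` for the value `w_j^{[m+1]}` computed without the entry `a_{ij}`.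
The cavity row sum at `i` removes the whole row `i` from `w_j`, while AMP uses `w_j` itself. Since
`w_j^{[m+1]} - w⁰_j = n^{-1/2} a_{ij} f_m(w_{{j},i}^{[m]})` exactly
(`cavity_sub_erasedCavity`), a first-order Taylor expansion of `f_{m+1}` at `w⁰_j` produces
`n⁻¹ ∑_j a_{ij}² f'_{m+1}(w⁰_j) f_m(w_{{j},i}^{[m]})`, which becomes the Onsager term up to
`O(n^{-1/2})` when `a_{ij}²` is replaced by its mean `1`; the Taylor remainder is
`n^{-3/2} ∑_j O(|a_{ij}|³)`. What is left is the sum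
`n^{-1/2} ∑_j a_{ij} (f_{m+1}(w⁰_j) - f_{m+1}(w_{{i},j}))` and the fluctuation
`n⁻¹ ∑_j (a_{ij}² - 1) (…)`. In both, the `j`-th coefficient `Y_j` does not see `a_{ij}` but does see
the other entries of row `i`, so the terms are only approximately orthogonal. In a cross term with
`j ≠ j'`, subtracting from `Y_j` its value without `a_{ij'}`, and from `Y_{j'}` its value without
`a_{ij}`, does not change the expectation, so the cross term is bounded by the influence of a single
entry (`meanSqLe_sum_entry_mul`). This replaces Gaussian integration by parts, and only Lipschitz
bounds in `L²` are needed: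

* removing a vertex moves the cavity iteration by `O(n^{-1/2})` (`meanSqLe_cavity_insert`);
* erasing one entry moves it by `O(n^{-1/2})` at the end points of the entry and by `O(n⁻¹)`
  elsewhere (`meanSqLe_cavity_influence`).

Both follow by induction on the step, because row `j` is independent of `w_{S ∪ {j}}`, which makes
row sums exactly orthogonal.

*Stability.* Outside an event of probability `exp (-n)` the operator norm of `A` is at most `24 √n`,
by a net argument and sub-Gaussian tails (`exists_event_norm_le`). There the error of step `k` is
controlled by the defects (`exists_ampError_le`). On the exceptional event a crude polynomial bound
suffices. All constants are uniform over deterministic initial vectors, so by independence a random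
one is treated by Fubini.
-/

namespace CavityAMP

open MeasureTheory ProbabilityTheory

universe v

/-! ### Mean-square bounds -/

/-- `X` is square integrable and `𝔼 X² ≤ c`. -/
def MeanSqLe {Ω : Type*} [MeasurableSpace Ω] (P : Measure Ω) (X : Ω → ℝ) (c : ℝ) : Prop :=
  MemLp X 2 P ∧ ∫ ω, X ω ^ 2 ∂P ≤ c

namespace MeanSqLe

variable {Ω : Type*} [MeasurableSpace Ω] {P : Measure Ω} {X Y : Ω → ℝ} {a b c : ℝ}

lemma integrable_sq (h : MeanSqLe P X c) : Integrable (fun ω => X ω ^ 2) P :=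
  h.1.integrable_sq

lemma weaken (h : MeanSqLe P X a) (hab : a ≤ b) : MeanSqLe P X b := ⟨h.1, h.2.trans hab⟩

lemma zero : MeanSqLe P (fun _ => 0) 0 := ⟨MemLp.zero', by simp⟩

lemma add (hX : MeanSqLe P X a) (hY : MeanSqLe P Y b) :
    MeanSqLe P (fun ω => X ω + Y ω) (2 * a + 2 * b) := by
  refine ⟨hX.1.add hY.1, ?_⟩
  calc ∫ ω, (X ω + Y ω) ^ 2 ∂P ≤ ∫ ω, (2 * X ω ^ 2 + 2 * Y ω ^ 2) ∂P := by
        refine integral_mono (hX.1.add hY.1).integrable_sq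
          ((hX.integrable_sq.const_mul 2).add (hY.integrable_sq.const_mul 2)) fun ω => ?_
        nlinarith [sq_nonneg (X ω - Y ω)]
    _ = 2 * ∫ ω, X ω ^ 2 ∂P + 2 * ∫ ω, Y ω ^ 2 ∂P := by
        rw [integral_add (hX.integrable_sq.const_mul 2) (hY.integrable_sq.const_mul 2),
          integral_const_mul, integral_const_mul]
    _ ≤ 2 * a + 2 * b := by linarith [hX.2, hY.2]

lemma const_mul (hX : MeanSqLe P X a) (r : ℝ) : MeanSqLe P (fun ω => r * X ω) (r ^ 2 * a) := by
  refine ⟨hX.1.const_mul r, ?_⟩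
  simp only [mul_pow]
  rw [integral_const_mul]
  exact mul_le_mul_of_nonneg_left hX.2 (sq_nonneg r)

lemma neg (hX : MeanSqLe P X a) : MeanSqLe P (fun ω => -X ω) a := by
  simpa using hX.const_mul (-1)

lemma sub (hX : MeanSqLe P X a) (hY : MeanSqLe P Y b) :
    MeanSqLe P (fun ω => X ω - Y ω) (2 * a + 2 * b) := by
  simpa [sub_eq_add_neg] using hX.add hY.neg

/-- Domination `|Y| ≤ r |X|`, the form in which Lipschitz bounds enter. -/
lemma dominated (hX : MeanSqLe P X a) (hY : Measurable Y) (r : ℝ)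
    (h : ∀ ω, |Y ω| ≤ r * |X ω|) : MeanSqLe P Y (r ^ 2 * a) := by
  have h' := hX.const_mul r
  have hle : ∀ ω, |Y ω| ≤ |r * X ω| := fun ω => (h ω).trans (by
    rw [abs_mul]; exact mul_le_mul_of_nonneg_right (le_abs_self r) (abs_nonneg _))
  have hm : MemLp Y 2 P := h'.1.of_le hY.aestronglyMeasurable
    (Filter.Eventually.of_forall fun ω => by simpa only [Real.norm_eq_abs] using hle ω)
  exact ⟨hm, (integral_mono hm.integrable_sq h'.integrable_sq fun ω => sq_le_sq.mpr (hle ω)).trans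
    h'.2⟩

lemma of_abs_le [IsProbabilityMeasure P] (hY : Measurable Y) (h : ∀ ω, |Y ω| ≤ b) :
    MeanSqLe P Y (b ^ 2) := by
  have h1 : MeanSqLe P (fun _ : Ω => (1 : ℝ)) 1 := ⟨memLp_const 1, by simp⟩
  simpa using h1.dominated hY b (by simpa using h)

/-- Cauchy–Schwarz for a sum of `|s|` terms. -/
lemma sum {ι : Type*} (s : Finset ι) {X : ι → Ω → ℝ} {c : ι → ℝ}
    (h : ∀ j ∈ s, MeanSqLe P (X j) (c j)) :
    MeanSqLe P (fun ω => ∑ j ∈ s, X j ω) (s.card * ∑ j ∈ s, c j) := by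
  have hm : MemLp (fun ω => ∑ j ∈ s, X j ω) 2 P := memLp_finsetSum s fun j hj => (h j hj).1
  refine ⟨hm, ?_⟩
  calc ∫ ω, (∑ j ∈ s, X j ω) ^ 2 ∂P ≤ ∫ ω, (s.card : ℝ) * ∑ j ∈ s, X j ω ^ 2 ∂P :=
        integral_mono hm.integrable_sq
          ((integrable_finsetSum s fun j hj => (h j hj).integrable_sq).const_mul _)
          fun ω => sq_sum_le_card_mul_sum_sq
    _ = s.card * ∑ j ∈ s, ∫ ω, X j ω ^ 2 ∂P := by
        rw [integral_const_mul, integral_finsetSum s fun j hj => (h j hj).integrable_sq]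
    _ ≤ s.card * ∑ j ∈ s, c j := by
        gcongr with j hj
        exact (h j hj).2

/-- An average of `n` terms (possibly over fewer than `n` indices) is as small as its terms. -/
lemma average {n : ℕ} (s : Finset (Fin n)) {X : Fin n → Ω → ℝ} (hc : 0 ≤ c)
    (h : ∀ j ∈ s, MeanSqLe P (X j) c) :
    MeanSqLe P (fun ω => 1 / (n : ℝ) * ∑ j ∈ s, X j ω) c := by
  refine ((MeanSqLe.sum s h).const_mul (1 / (n : ℝ))).weaken ?_
  have hs : (s.card : ℝ) ≤ n := by exact_mod_cast (card_finset_fin_le s)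
  rw [Finset.sum_const, nsmul_eq_mul]
  rcases Nat.eq_zero_or_pos n with rfl | hn
  · simpa using hc
  have hn' : (0 : ℝ) < n := by exact_mod_cast hn
  have h0 : (0 : ℝ) ≤ s.card := by positivity
  calc (1 / (n : ℝ)) ^ 2 * (s.card * (s.card * c)) ≤ (1 / (n : ℝ)) ^ 2 * (n * (n * c)) := by
        gcongr
    _ = c := by field_simp

end MeanSqLe

/-! ### Erasing one entry of the disorder -/

/-- The matrix `B` with the two symmetric entries `(i, j)` and `(j, i)` replaced by `0`. -/
def eraseEntry {n : ℕ} (i j : Fin n) (B : Fin n → Fin n → ℝ) : Fin n → Fin n → ℝ :=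
  fun p q => if (p = i ∧ q = j) ∨ (p = j ∧ q = i) then 0 else B p q

section eraseEntry

variable {n : ℕ}

lemma eraseEntry_of_ne {i j p q : Fin n} (B : Fin n → Fin n → ℝ)
    (h1 : ¬(p = i ∧ q = j)) (h2 : ¬(p = j ∧ q = i)) : eraseEntry i j B p q = B p q := by
  simp [eraseEntry, h1, h2]

lemma eraseEntry_swap (i j : Fin n) (B : Fin n → Fin n → ℝ) :
    eraseEntry i j B = eraseEntry j i B := by
  funext p q
  simp only [eraseEntry]
  congr 1
  exact propext or_comm

lemma eraseEntry_idem (i j : Fin n) (B : Fin n → Fin n → ℝ) :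
    eraseEntry i j (eraseEntry i j B) = eraseEntry i j B := by
  funext p q
  simp only [eraseEntry]
  split_ifs <;> rfl

lemma eraseEntry_comm (i j k l : Fin n) (B : Fin n → Fin n → ℝ) :
    eraseEntry i j (eraseEntry k l B) = eraseEntry k l (eraseEntry i j B) := by
  funext p q
  simp only [eraseEntry]
  split_ifs <;> rfl

lemma measurable_eraseEntry (i j : Fin n) : Measurable (eraseEntry (n := n) i j) := by
  refine measurable_pi_lambda _ fun p => measurable_pi_lambda _ fun q => ?_
  simp only [eraseEntry]
  split_ifs
  · exact measurable_const
  · fun_prop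

end eraseEntry

namespace IsGaussianDisorder

variable {Ω : Type*} [MeasurableSpace Ω] {n : ℕ} {P : Measure Ω} {A : Ω → Fin n → Fin n → ℝ}

lemma measurable_entry (hA : IsGaussianDisorder P A) (i j : Fin n) :
    Measurable fun ω => A ω i j :=
  (measurable_pi_apply j).comp ((measurable_pi_apply i).comp hA.measurable)

lemma map_entry (hA : IsGaussianDisorder P A) {i j : Fin n} (hij : i ≠ j) :
    P.map (fun ω => A ω i j) = gaussianReal 0 1 := by
  rcases lt_or_gt_of_ne hij with h | h
  · exact hA.law i j h
  · simp_rw [fun ω => hA.symm ω i j]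
    exact hA.law j i h

/-- An entry is independent of the disorder from which it has been erased. -/
lemma indepFun_eraseEntry (hA : IsGaussianDisorder P A) {i j : Fin n} (hij : i ≠ j) :
    IndepFun (fun ω => A ω i j) (fun ω => eraseEntry i j (A ω)) P := by
  wlog h : i < j generalizing i j
  · have := this hij.symm (lt_of_le_of_ne (not_lt.mp h) hij.symm)
    simp_rw [fun ω => hA.symm ω i j, fun ω => eraseEntry_swap i j (A ω)]
    exact this
  classical
  let E := {e : Fin n × Fin n // e.1 < e.2}
  let e₀ : E := ⟨(i, j), h⟩
  have hind := hA.indep.indepFun_finset {e₀} (Finset.univ.erase e₀) (by simp)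
    (fun e => hA.measurable_entry e.1.1 e.1.2)
  -- Rebuild the erased matrix from the entries above the diagonal other than `(i, j)`.
  let G : (↥(Finset.univ.erase e₀) → ℝ) → Fin n → Fin n → ℝ := fun x p q =>
    if hpq : p < q then
      if he : (⟨(p, q), hpq⟩ : E) ∈ Finset.univ.erase e₀ then x ⟨_, he⟩ else 0
    else if hqp : q < p then
      if he : (⟨(q, p), hqp⟩ : E) ∈ Finset.univ.erase e₀ then x ⟨_, he⟩ else 0
    else 0
  have hG : Measurable G := by
    refine measurable_pi_lambda _ fun p => measurable_pi_lambda _ fun q => ?_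
    simp only [G]
    split_ifs <;> fun_prop
  let o : ↥({e₀} : Finset E) := ⟨e₀, Finset.mem_singleton_self e₀⟩
  have ho : Measurable fun x : ↥({e₀} : Finset E) → ℝ => x o := measurable_pi_apply o
  have hcomp := hind.comp (φ := fun x => x o) (ψ := G) ho hG
  have h2 : (fun ω => eraseEntry i j (A ω)) =
      G ∘ fun ω (e : ↥(Finset.univ.erase e₀)) => A ω e.1.1.1 e.1.1.2 := by
    funext ω p q
    simp only [Function.comp, G, eraseEntry]
    rcases lt_trichotomy p q with hpq | hpq | hpq
    · simp only [hpq, dite_true, Finset.mem_erase, Finset.mem_univ, and_true, ne_eq, e₀,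
        Subtype.mk.injEq, Prod.mk.injEq]
      by_cases h1 : p = i ∧ q = j
      · simp [h1]
      · have h3 : ¬(p = j ∧ q = i) := by rintro ⟨rfl, rfl⟩; exact lt_asymm h hpq
        simp [h1, h3]
    · subst hpq
      simp [hA.diag]
    · simp only [hpq, not_lt_of_gt hpq, dite_true, dite_false, Finset.mem_erase, Finset.mem_univ,
        and_true, ne_eq, e₀, Subtype.mk.injEq, Prod.mk.injEq]
      by_cases h1 : q = i ∧ p = j
      · simp [h1]
      · have h3 : ¬(p = i ∧ q = j) := by rintro ⟨rfl, rfl⟩; exact lt_asymm h hpq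
        have h4 : ¬(p = j ∧ q = i) := fun h => h1 ⟨h.2, h.1⟩
        simp [h1, h3, h4, hA.symm ω p q]
  rw [h2]
  exact hcomp

/-- A function of the disorder that does not see the entry `(i, j)` factors out of the
expectation. -/
lemma integral_entry_mul (hA : IsGaussianDisorder P A) {i j : Fin n} (hij : i ≠ j)
    {φ : ℝ → ℝ} (hφ : Measurable φ) {F : (Fin n → Fin n → ℝ) → ℝ} (hF : Measurable F)
    (hFe : ∀ B, F (eraseEntry i j B) = F B) :
    ∫ ω, φ (A ω i j) * F (A ω) ∂P = (∫ x, φ x ∂gaussianReal 0 1) * ∫ ω, F (A ω) ∂P := by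
  have h := (hA.indepFun_eraseEntry hij).integral_fun_comp_mul_comp (f := φ) (g := F)
    (hA.measurable_entry i j).aemeasurable
    ((measurable_eraseEntry i j).comp hA.measurable).aemeasurable
    hφ.aestronglyMeasurable hF.aestronglyMeasurable
  simp only [hFe] at h
  rw [h, ← hA.map_entry hij, integral_map (hA.measurable_entry i j).aemeasurable
    hφ.aestronglyMeasurable]

lemma integrable_entry_mul (hA : IsGaussianDisorder P A) {i j : Fin n} (hij : i ≠ j)
    {φ : ℝ → ℝ} (hφ : Measurable φ) (hφi : Integrable φ (gaussianReal 0 1))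
    {F : (Fin n → Fin n → ℝ) → ℝ} (hF : Measurable F)
    (hFe : ∀ B, F (eraseEntry i j B) = F B) (hFi : Integrable (fun ω => F (A ω)) P) :
    Integrable (fun ω => φ (A ω i j) * F (A ω)) P := by
  have h := (hA.indepFun_eraseEntry hij).comp hφ hF
  have h2 : F ∘ (fun ω => eraseEntry i j (A ω)) = fun ω => F (A ω) := by
    funext ω; exact hFe _
  rw [h2] at h
  refine h.integrable_mul ?_ hFi
  rw [← hA.map_entry hij] at hφi
  exact (integrable_map_measure hφ.aestronglyMeasurable
    (hA.measurable_entry i j).aemeasurable).mp hφi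

/-- Multiplying by a function of an independent entry multiplies the mean square. -/
lemma meanSqLe_entry_mul (hA : IsGaussianDisorder P A) {i j : Fin n} (hij : i ≠ j)
    {φ : ℝ → ℝ} (hφ : Measurable φ) (hφi : Integrable (fun x => φ x ^ 2) (gaussianReal 0 1))
    {F : (Fin n → Fin n → ℝ) → ℝ} (hF : Measurable F)
    (hFe : ∀ B, F (eraseEntry i j B) = F B) {c : ℝ} (h : MeanSqLe P (fun ω => F (A ω)) c) :
    MeanSqLe P (fun ω => φ (A ω i j) * F (A ω)) ((∫ x, φ x ^ 2 ∂gaussianReal 0 1) * c) := by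
  have hFA : Measurable fun ω => F (A ω) := hF.comp hA.measurable
  have hφA : Measurable fun ω => φ (A ω i j) := hφ.comp (hA.measurable_entry i j)
  have hFe2 : ∀ B, F (eraseEntry i j B) ^ 2 = F B ^ 2 := fun B => by rw [hFe]
  constructor
  · refine (memLp_two_iff_integrable_sq (hφA.mul hFA).aestronglyMeasurable).mpr ?_
    simpa only [Pi.mul_apply, mul_pow] using hA.integrable_entry_mul hij (hφ.pow_const 2) hφi
      (hF.pow_const 2) hFe2 h.integrable_sq
  · simp only [mul_pow]
    rw [hA.integral_entry_mul hij (hφ.pow_const 2) (hF.pow_const 2) hFe2]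
    exact mul_le_mul_of_nonneg_left h.2 (integral_nonneg fun x => sq_nonneg _)

end IsGaussianDisorder

/-! ### Approximate orthogonality -/

namespace IsGaussianDisorder

variable {Ω : Type*} [MeasurableSpace Ω] {n : ℕ} {P : Measure Ω} [IsProbabilityMeasure P]
  {A : Ω → Fin n → Fin n → ℝ}

lemma memLp_entry (hA : IsGaussianDisorder P A) {i j : Fin n} (hij : i ≠ j)
    {φ : ℝ → ℝ} (hφ : Measurable φ) (hφi : Integrable (fun x => φ x ^ 2) (gaussianReal 0 1)) :
    MemLp (fun ω => φ (A ω i j)) 2 P := by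
  have h := hA.meanSqLe_entry_mul hij hφ hφi (F := fun _ => 1) measurable_const (fun _ => rfl)
    (MeanSqLe.of_abs_le (b := 1) measurable_const (by simp))
  simpa using h.1

/-- Two entries of one row, multiplied by factors `F` and `G` each of which does not see its own
entry. If the factors did not see each other's entry either, the expectation would vanish; so only
the influences `F - F ∘ eraseEntry i j'` and `G - G ∘ eraseEntry i j` contribute. -/
lemma integral_entry_mul_entry_le (hA : IsGaussianDisorder P A) {i j j' : Fin n} (hij : i ≠ j)
    (hij' : i ≠ j') (hjj : j ≠ j') {φ : ℝ → ℝ} (hφ : Measurable φ)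
    (hφi : Integrable (fun x => φ x ^ 2) (gaussianReal 0 1))
    (hφ0 : ∫ x, φ x ∂gaussianReal 0 1 = 0)
    {F G : (Fin n → Fin n → ℝ) → ℝ} (hF : Measurable F) (hG : Measurable G) {b : ℝ}
    (hFb : ∀ B, |F B| ≤ b) (hGb : ∀ B, |G B| ≤ b)
    (hFe : ∀ B, F (eraseEntry i j B) = F B) (hGe : ∀ B, G (eraseEntry i j' B) = G B) {β : ℝ}
    (hFβ : MeanSqLe P (fun ω => F (A ω) - F (eraseEntry i j' (A ω))) β)
    (hGβ : MeanSqLe P (fun ω => G (A ω) - G (eraseEntry i j (A ω))) β) :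
    Integrable (fun ω => (φ (A ω i j) * F (A ω)) * (φ (A ω i j') * G (A ω))) P ∧
    ∫ ω, (φ (A ω i j) * F (A ω)) * (φ (A ω i j') * G (A ω)) ∂P ≤
      (∫ x, φ x ^ 2 ∂gaussianReal 0 1) * β := by
  have hint : ∀ H K : (Fin n → Fin n → ℝ) → ℝ, Measurable H → Measurable K →
      (∀ B, |H B| ≤ b) → (∀ B, |K B| ≤ b) →
      Integrable (fun ω => φ (A ω i j) * φ (A ω i j') * (H (A ω) * K (A ω))) P := by
    intro H K hH hK hHb hKb
    refine ((hA.memLp_entry hij hφ hφi).integrable_mul (hA.memLp_entry hij' hφ hφi)).mul_bdd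
      (c := b * b) ((hH.mul hK).comp hA.measurable).aestronglyMeasurable
      (Filter.Eventually.of_forall fun ω => ?_)
    rw [Real.norm_eq_abs]
    rw [abs_mul]
    exact mul_le_mul (hHb _) (hKb _) (abs_nonneg _) ((abs_nonneg _).trans (hHb (A ω)))
  have hrow : ∀ B : Fin n → Fin n → ℝ, eraseEntry i j B i j' = B i j' := fun B =>
    eraseEntry_of_ne B (fun h => hjj h.2.symm) (fun h => hij h.1)
  have hrow' : ∀ B : Fin n → Fin n → ℝ, eraseEntry i j' B i j = B i j := fun B =>
    eraseEntry_of_ne B (fun h => hjj h.2) (fun h => hij' h.1)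
  have hmrow : ∀ j : Fin n, Measurable fun B : Fin n → Fin n → ℝ => φ (B i j) := fun j =>
    hφ.comp ((measurable_pi_apply j).comp (measurable_pi_apply i))
  -- The expectation vanishes as soon as the factors are blind to one of the two entries.
  have hzero : ∀ H : (Fin n → Fin n → ℝ) → ℝ, Measurable H →
      (∀ B, H (eraseEntry i j B) = H B) →
      ∫ ω, φ (A ω i j) * φ (A ω i j') * H (A ω) ∂P = 0 := by
    intro H hH hHe
    have := hA.integral_entry_mul hij hφ (F := fun B => φ (B i j') * H B) ((hmrow j').mul hH)
      (fun B => by simp only [hrow, hHe])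
    simpa only [mul_assoc, hφ0, zero_mul] using this
  have hzero' : ∀ H : (Fin n → Fin n → ℝ) → ℝ, Measurable H →
      (∀ B, H (eraseEntry i j' B) = H B) →
      ∫ ω, φ (A ω i j) * φ (A ω i j') * H (A ω) ∂P = 0 := by
    intro H hH hHe
    have := hA.integral_entry_mul hij' hφ (F := fun B => φ (B i j) * H B) ((hmrow j).mul hH)
      (fun B => by simp only [hrow', hHe])
    rw [hφ0, zero_mul] at this
    rw [← this]
    congr 1; funext ω; ring
  have hFm := hF.comp (measurable_eraseEntry i j')
  have hGm := hG.comp (measurable_eraseEntry i j)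
  have i1 := hint F (G ∘ eraseEntry i j) hF hGm hFb (fun B => hGb _)
  have i2 := hint (F ∘ eraseEntry i j') G hFm hG (fun B => hFb _) hGb
  have i3 := hint (F ∘ eraseEntry i j') (G ∘ eraseEntry i j) hFm hGm (fun B => hFb _)
    (fun B => hGb _)
  have i0 := hint F G hF hG hFb hGb
  have z1 := hzero (fun B => F B * (G ∘ eraseEntry i j) B) (hF.mul hGm) fun B => by
    simp only [Function.comp, hFe, eraseEntry_idem]
  have z2 := hzero' (fun B => (F ∘ eraseEntry i j') B * G B) (hFm.mul hG) fun B => by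
    simp only [Function.comp, hGe, eraseEntry_idem]
  have z3 := hzero (fun B => (F ∘ eraseEntry i j') B * (G ∘ eraseEntry i j) B) (hFm.mul hGm)
    fun B => by simp only [Function.comp, eraseEntry_comm i j' i j, hFe, eraseEntry_idem]
  have hΔF := hA.meanSqLe_entry_mul hij hφ hφi (F := fun B => F B - F (eraseEntry i j' B))
    (hF.sub hFm) (fun B => by simp only [eraseEntry_comm i j' i j, hFe]) hFβ
  have hΔG := hA.meanSqLe_entry_mul hij' hφ hφi (F := fun B => G B - G (eraseEntry i j B))
    (hG.sub hGm) (fun B => by simp only [eraseEntry_comm i j i j', hGe]) hGβ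
  have hrw : (fun ω => (φ (A ω i j) * F (A ω)) * (φ (A ω i j') * G (A ω))) =
      fun ω => φ (A ω i j) * φ (A ω i j') * (F (A ω) * G (A ω)) := by
    funext ω; ring
  rw [hrw]
  refine ⟨i0, ?_⟩
  have e1 : ∫ ω, φ (A ω i j) * φ (A ω i j') * (F (A ω) * G (A ω)) ∂P =
      ∫ ω, (φ (A ω i j) * (F (A ω) - F (eraseEntry i j' (A ω)))) *
        (φ (A ω i j') * (G (A ω) - G (eraseEntry i j (A ω)))) ∂P := by
    have : (fun ω => (φ (A ω i j) * (F (A ω) - F (eraseEntry i j' (A ω)))) *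
        (φ (A ω i j') * (G (A ω) - G (eraseEntry i j (A ω))))) = fun ω =>
        φ (A ω i j) * φ (A ω i j') * (F (A ω) * G (A ω)) -
        φ (A ω i j) * φ (A ω i j') * (F (A ω) * (G ∘ eraseEntry i j) (A ω)) -
        φ (A ω i j) * φ (A ω i j') * ((F ∘ eraseEntry i j') (A ω) * G (A ω)) +
        φ (A ω i j) * φ (A ω i j') *
          ((F ∘ eraseEntry i j') (A ω) * (G ∘ eraseEntry i j) (A ω)) := by
      funext ω
      simp only [Function.comp]
      ring
    rw [this]
    have h1 := integral_sub i0 i1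
    have h2 := integral_sub (i0.sub i1) i2
    have h3 := integral_add ((i0.sub i1).sub i2) i3
    simp only [Pi.sub_apply] at h1 h2 h3
    rw [h3, h2, h1, z1, z2, z3]
    ring
  rw [e1]
  calc _ ≤ ∫ ω, (1 / 2 * (φ (A ω i j) * (F (A ω) - F (eraseEntry i j' (A ω)))) ^ 2 +
        1 / 2 * (φ (A ω i j') * (G (A ω) - G (eraseEntry i j (A ω)))) ^ 2) ∂P := by
        refine integral_mono (hΔF.1.integrable_mul hΔG.1)
          ((hΔF.integrable_sq.const_mul _).add (hΔG.integrable_sq.const_mul _)) fun ω => ?_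
        nlinarith [sq_nonneg (φ (A ω i j) * (F (A ω) - F (eraseEntry i j' (A ω))) -
          φ (A ω i j') * (G (A ω) - G (eraseEntry i j (A ω))))]
    _ ≤ _ := by
        rw [integral_add (hΔF.integrable_sq.const_mul _) (hΔG.integrable_sq.const_mul _),
          integral_const_mul, integral_const_mul]
        linarith [hΔF.2, hΔG.2]

/-- Approximate orthogonality along a row. If `Y j` does not see the entry `(i, j)`, has mean
square at most `α j`, and every other entry of the row has mean-square influence at most `β` on it,
then the terms of `∑ j, φ (A i j) * Y j` are orthogonal up to `β`. -/
lemma meanSqLe_sum_entry_mul (hA : IsGaussianDisorder P A) {i : Fin n} {s : Finset (Fin n)}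
    (hi : i ∉ s) {φ : ℝ → ℝ} (hφ : Measurable φ)
    (hφi : Integrable (fun x => φ x ^ 2) (gaussianReal 0 1))
    (hφ0 : ∫ x, φ x ∂gaussianReal 0 1 = 0)
    {Y : Fin n → (Fin n → Fin n → ℝ) → ℝ} (hY : ∀ j ∈ s, Measurable (Y j)) {b : ℝ}
    (hYb : ∀ j ∈ s, ∀ B, |Y j B| ≤ b) (hYe : ∀ j ∈ s, ∀ B, Y j (eraseEntry i j B) = Y j B)
    {α : Fin n → ℝ} {β : ℝ} (hβ0 : 0 ≤ β) (hα : ∀ j ∈ s, MeanSqLe P (fun ω => Y j (A ω)) (α j))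
    (hβ : ∀ j ∈ s, ∀ j' ∈ s, j ≠ j' →
      MeanSqLe P (fun ω => Y j (A ω) - Y j (eraseEntry i j' (A ω))) β) :
    MeanSqLe P (fun ω => ∑ j ∈ s, φ (A ω i j) * Y j (A ω))
      ((∫ x, φ x ^ 2 ∂gaussianReal 0 1) * (∑ j ∈ s, α j + n ^ 2 * β)) := by
  have hne : ∀ j ∈ s, i ≠ j := fun j hj h => hi (h ▸ hj)
  have hdiag : ∀ j ∈ s, MeanSqLe P (fun ω => φ (A ω i j) * Y j (A ω))
      ((∫ x, φ x ^ 2 ∂gaussianReal 0 1) * α j) := fun j hj =>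
    hA.meanSqLe_entry_mul (hne j hj) hφ hφi (hY j hj) (hYe j hj) (hα j hj)
  set v := ∫ x, φ x ^ 2 ∂gaussianReal 0 1 with hv
  have hv0 : 0 ≤ v := integral_nonneg fun x => sq_nonneg _
  have hmem : MemLp (fun ω => ∑ j ∈ s, φ (A ω i j) * Y j (A ω)) 2 P :=
    memLp_finsetSum s fun j hj => (hdiag j hj).1
  refine ⟨hmem, ?_⟩
  have hterm : ∀ j ∈ s, ∀ j' ∈ s,
      ∫ ω, (φ (A ω i j) * Y j (A ω)) * (φ (A ω i j') * Y j' (A ω)) ∂P ≤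
        (if j = j' then v * α j else 0) + v * β := by
    intro j hj j' hj'
    by_cases hjj : j = j'
    · subst hjj
      have := (hdiag j hj).2
      simp only [sq] at this
      simp only [if_true]
      nlinarith [mul_nonneg hv0 hβ0]
    · simp only [hjj, if_false, zero_add]
      exact (hA.integral_entry_mul_entry_le (hne j hj) (hne j' hj') hjj hφ hφi hφ0 (hY j hj)
        (hY j' hj') (hYb j hj) (hYb j' hj') (hYe j hj) (hYe j' hj') (hβ j hj j' hj' hjj)
        (hβ j' hj' j hj (Ne.symm hjj))).2
  have hint : ∀ j ∈ s, ∀ j' ∈ s,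
      Integrable (fun ω => (φ (A ω i j) * Y j (A ω)) * (φ (A ω i j') * Y j' (A ω))) P :=
    fun j hj j' hj' => (hdiag j hj).1.integrable_mul (hdiag j' hj').1
  have hs : (s.card : ℝ) ≤ n := by exact_mod_cast (card_finset_fin_le s)
  calc ∫ ω, (∑ j ∈ s, φ (A ω i j) * Y j (A ω)) ^ 2 ∂P
      = ∑ j ∈ s, ∑ j' ∈ s,
          ∫ ω, (φ (A ω i j) * Y j (A ω)) * (φ (A ω i j') * Y j' (A ω)) ∂P := by
        simp_rw [sq, Finset.sum_mul_sum]
        rw [integral_finsetSum s fun j hj => integrable_finsetSum s fun j' hj' => hint j hj j' hj']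
        exact Finset.sum_congr rfl fun j hj => integral_finsetSum s fun j' hj' => hint j hj j' hj'
    _ ≤ ∑ j ∈ s, ∑ j' ∈ s, ((if j = j' then v * α j else 0) + v * β) :=
        Finset.sum_le_sum fun j hj => Finset.sum_le_sum fun j' hj' => hterm j hj j' hj'
    _ = v * ∑ j ∈ s, α j + s.card ^ 2 * (v * β) := by
        simp only [Finset.sum_add_distrib, Finset.sum_ite_eq, Finset.sum_const, nsmul_eq_mul,
          Finset.sum_ite_mem, Finset.inter_self, Finset.mul_sum]
        ring
    _ ≤ v * ∑ j ∈ s, α j + n ^ 2 * (v * β) := by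
        have := mul_nonneg hv0 hβ0
        gcongr
    _ = v * (∑ j ∈ s, α j + n ^ 2 * β) := by ring

end IsGaussianDisorder

/-! ### Nonlinearities -/

/-- All that is used about a nonlinearity `g`: one constant `M` bounds `g` and `g'`, is a Lipschitz
constant of both, and controls the first-order Taylor remainder. -/
structure RegularWith (g : ℝ → ℝ) (M : ℝ) : Prop where
  nonneg : 0 ≤ M
  measurable : Measurable g
  measurable_deriv : Measurable (deriv g)
  bound : ∀ x, |g x| ≤ M
  deriv_bound : ∀ x, |deriv g x| ≤ M
  lipschitz : ∀ x y, |g x - g y| ≤ M * |x - y|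
  deriv_lipschitz : ∀ x y, |deriv g x - deriv g y| ≤ M * |x - y|
  taylor : ∀ x d, |g (x + d) - g x - deriv g x * d| ≤ M * d ^ 2

lemma SmoothBounded.exists_regularWith {g : ℝ → ℝ} (hg : SmoothBounded g) :
    ∃ M, RegularWith g M := by
  obtain ⟨hsm, hb⟩ := hg
  obtain ⟨M0, h0⟩ := hb 0
  obtain ⟨M1, h1⟩ := hb 1
  obtain ⟨M2, h2⟩ := hb 2
  simp only [iteratedDeriv_zero] at h0
  simp only [iteratedDeriv_one] at h1
  have h2' : ∀ x, |deriv (deriv g) x| ≤ M2 := fun x => by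
    have := h2 x
    rwa [show (2 : ℕ) = 1 + 1 from rfl, iteratedDeriv_succ, iteratedDeriv_one] at this
  have hdg : Differentiable ℝ g := hsm.differentiable (by simp)
  have hsm1 : ContDiff ℝ 1 (deriv g) := by
    have h : ContDiff ℝ 2 g := contDiff_infty.mp hsm 2
    exact ContDiff.deriv' h
  have hddg : Differentiable ℝ (deriv g) := hsm1.differentiable (by simp)
  have lip : ∀ (h : ℝ → ℝ) (C : ℝ), Differentiable ℝ h → (∀ x, |deriv h x| ≤ C) →
      ∀ x y, |h x - h y| ≤ C * |x - y| := by
    intro h C hd hC x y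
    have := convex_univ.norm_image_sub_le_of_norm_deriv_le (f := h) (C := C)
      (fun z _ => hd z) (fun z _ => by simpa using hC z) (Set.mem_univ y) (Set.mem_univ x)
    simpa using this
  have hM0 : 0 ≤ M0 := (abs_nonneg _).trans (h0 0)
  have hM1 : 0 ≤ M1 := (abs_nonneg _).trans (h1 0)
  have hM2 : 0 ≤ M2 := (abs_nonneg _).trans (h2' 0)
  have lip0 := lip g M1 hdg h1
  have lip1 := lip (deriv g) M2 hddg h2'
  refine ⟨M0 + M1 + M2, by positivity, hdg.continuous.measurable, measurable_deriv g,
    fun x => by linarith [h0 x], fun x => by linarith [h1 x], fun x y => ?_, fun x y => ?_,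
    fun x d => ?_⟩
  · nlinarith [lip0 x y, abs_nonneg (x - y), mul_nonneg hM0 (abs_nonneg (x - y)),
      mul_nonneg hM2 (abs_nonneg (x - y))]
  · nlinarith [lip1 x y, abs_nonneg (x - y), mul_nonneg hM0 (abs_nonneg (x - y)),
      mul_nonneg hM1 (abs_nonneg (x - y))]
  · have hder : ∀ y, HasDerivAt (fun z => g z - deriv g x * z) (deriv g y - deriv g x) y :=
      fun y => by
        have := (hdg y).hasDerivAt.fun_sub ((hasDerivAt_id' y).const_mul (deriv g x))
        rwa [mul_one] at this
    have := (convex_closedBall x |d|).norm_image_sub_le_of_norm_deriv_le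
      (f := fun z => g z - deriv g x * z) (C := M2 * |d|)
      (fun z _ => (hder z).differentiableAt) (fun z hz => by
        rw [(hder z).deriv, Real.norm_eq_abs]
        refine (lip1 z x).trans (mul_le_mul_of_nonneg_left ?_ hM2)
        simpa [Real.dist_eq] using hz)
      (x := x) (y := x + d) (by simp) (by simp)
    simp only [Real.norm_eq_abs] at this
    rw [show g (x + d) - deriv g x * (x + d) - (g x - deriv g x * x) =
      g (x + d) - g x - deriv g x * d by ring, add_sub_cancel_left] at this
    calc _ ≤ M2 * |d| * |d| := this
      _ = M2 * d ^ 2 := by rw [mul_assoc, ← sq, sq_abs]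
      _ ≤ _ := by nlinarith [sq_nonneg d, mul_nonneg hM0 (sq_nonneg d),
        mul_nonneg hM1 (sq_nonneg d)]

/-! ### Gaussian moments -/

lemma integrable_pow_gaussianReal (m : ℕ) :
    Integrable (fun x : ℝ => x ^ m) (gaussianReal 0 1) := by
  have h := (memLp_id_gaussianReal' (μ := 0) (v := 1) m (by simp)).integrable_norm_pow'
  exact h.mono' (by fun_prop) (Filter.Eventually.of_forall fun x => by simp)

lemma integral_sq_gaussianReal : ∫ x, x ^ 2 ∂gaussianReal 0 1 = 1 := by
  have h := variance_id_gaussianReal (μ := 0) (v := 1)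
  rw [variance_eq_sub (memLp_id_gaussianReal' 2 (by simp))] at h
  simpa using h

/-! ### The cavity iteration -/

section cavity

variable {n : ℕ} {f : ℕ → ℝ → ℝ}

lemma cavity_succ (B : Fin n → Fin n → ℝ) (u : Fin n → ℝ) (k : ℕ) (S : Finset (Fin n))
    (i : Fin n) :
    cavity f B u (k + 1) S i = 1 / Real.sqrt n *
      ∑ j ∈ Finset.univ \ (S ∪ {i}), B i j * f k (cavity f B u k (S ∪ {i}) j) := by
  rw [cavity]

lemma measurable_cavity_uncurry (hf : ∀ k, Measurable (f k)) (k : ℕ) (S : Finset (Fin n))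
    (i : Fin n) :
    Measurable fun p : (Fin n → Fin n → ℝ) × (Fin n → ℝ) => cavity f p.1 p.2 k S i := by
  induction k generalizing S i with
  | zero => simp only [cavity]; fun_prop
  | succ k ih =>
    simp only [cavity_succ]
    refine (Finset.measurable_fun_sum _ fun j _ => ?_).const_mul _
    exact (by fun_prop : Measurable fun p : (Fin n → Fin n → ℝ) × (Fin n → ℝ) => p.1 i j).mul
      ((hf k).comp (ih _ j))

lemma measurable_cavity (hf : ∀ k, Measurable (f k)) (u : Fin n → ℝ) (k : ℕ)
    (S : Finset (Fin n)) (i : Fin n) :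
    Measurable fun B : Fin n → Fin n → ℝ => cavity f B u k S i :=
  (measurable_cavity_uncurry hf k S i).comp (by fun_prop : Measurable fun B => (B, u))

/-- Rows indexed by `S` are invisible to `cavity f B u k S`. -/
lemma cavity_eraseEntry (u : Fin n → ℝ) (k : ℕ) {S : Finset (Fin n)} {i j l : Fin n}
    (hS : i ∈ S ∨ j ∈ S) (hl : l ∉ S) (B : Fin n → Fin n → ℝ) :
    cavity f (eraseEntry i j B) u k S l = cavity f B u k S l := by
  induction k generalizing S l with
  | zero => simp only [cavity]
  | succ k ih =>
    simp only [cavity_succ]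
    congr 1
    refine Finset.sum_congr rfl fun p hp => ?_
    simp only [Finset.mem_sdiff, Finset.mem_univ, true_and, Finset.mem_union,
      Finset.mem_singleton, not_or] at hp
    rw [ih (by simp only [Finset.mem_union]; tauto) (by simp [hp]), eraseEntry_of_ne]
    · rintro ⟨rfl, rfl⟩; tauto
    · rintro ⟨rfl, rfl⟩; tauto

/-- At a vertex `i`, the cavity iteration depends on the entry `(i, j)` through a single term. -/
lemma cavity_sub_cavity_eraseEntry (u : Fin n → ℝ) (k : ℕ) {S : Finset (Fin n)} {i j : Fin n}
    (hij : i ≠ j) (hjS : j ∉ S) (B : Fin n → Fin n → ℝ) :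
    cavity f B u (k + 1) S i - cavity f (eraseEntry i j B) u (k + 1) S i =
      1 / Real.sqrt n * (B i j * f k (cavity f B u k (S ∪ {i}) j)) := by
  simp only [cavity_succ]
  rw [← mul_sub, ← Finset.sum_sub_distrib]
  congr 1
  rw [Finset.sum_eq_single_of_mem j (by simp [hjS, hij.symm])]
  · simp [eraseEntry]
  · intro p hp hpj
    simp only [Finset.mem_sdiff, Finset.mem_univ, true_and, Finset.mem_union,
      Finset.mem_singleton, not_or] at hp
    rw [cavity_eraseEntry u k (by simp) (by simp [hp]), eraseEntry_of_ne _ (fun h => hpj h.2)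
      (fun h => hij h.1), sub_self]

end cavity

/-- The constant of `meanSqLe_cavity_insert`. -/
noncomputable def insertConst (M : ℕ → ℝ) : ℕ → ℝ
  | 0 => 0
  | k + 1 => 2 * M k ^ 2 + 2 * (M k ^ 2 * insertConst M k)

lemma insertConst_nonneg (M : ℕ → ℝ) (k : ℕ) : 0 ≤ insertConst M k := by
  induction k with
  | zero => simp [insertConst]
  | succ k ih => rw [insertConst]; positivity

/-- The constant of `meanSqLe_cavity_influence`. -/
noncomputable def influenceConst (M : ℕ → ℝ) : ℕ → ℝ
  | 0 => 0
  | k + 1 => M k ^ 2 + 3 * (M k ^ 2 * influenceConst M k)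

lemma influenceConst_nonneg (M : ℕ → ℝ) (k : ℕ) : 0 ≤ influenceConst M k := by
  induction k with
  | zero => simp [influenceConst]
  | succ k ih => rw [influenceConst]; positivity

namespace IsGaussianDisorder

variable {Ω : Type*} [MeasurableSpace Ω] {n : ℕ} {P : Measure Ω}
  {A : Ω → Fin n → Fin n → ℝ} {f : ℕ → ℝ → ℝ} {M : ℕ → ℝ}

lemma measurable_cavity (hA : IsGaussianDisorder P A) (hf : ∀ k, RegularWith (f k) (M k))
    (u : Fin n → ℝ) (k : ℕ) (S : Finset (Fin n)) (i : Fin n) :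
    Measurable fun ω => cavity f (A ω) u k S i :=
  (CavityAMP.measurable_cavity (fun k => (hf k).measurable) u k S i).comp hA.measurable

variable [IsProbabilityMeasure P]

/-- A normalized row sum whose coefficients do not see the row at all. -/
lemma meanSqLe_row_sum (hA : IsGaussianDisorder P A) {i : Fin n} {s : Finset (Fin n)}
    (hi : i ∉ s) {Y : Fin n → (Fin n → Fin n → ℝ) → ℝ} (hY : ∀ j ∈ s, Measurable (Y j)) {b : ℝ}
    (hYb : ∀ j ∈ s, ∀ B, |Y j B| ≤ b)
    (hYe : ∀ j ∈ s, ∀ j' ∈ s, ∀ B, Y j (eraseEntry i j' B) = Y j B)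
    {α : Fin n → ℝ} (hα : ∀ j ∈ s, MeanSqLe P (fun ω => Y j (A ω)) (α j)) :
    MeanSqLe P (fun ω => 1 / Real.sqrt n * ∑ j ∈ s, A ω i j * Y j (A ω))
      (1 / n * ∑ j ∈ s, α j) := by
  have h := hA.meanSqLe_sum_entry_mul hi measurable_id (integrable_pow_gaussianReal 2)
    integral_id_gaussianReal hY hYb (fun j hj => hYe j hj j hj) le_rfl hα
    (fun j hj j' hj' _ => by simpa only [hYe j hj j' hj', sub_self] using MeanSqLe.zero)
  simp only [id, integral_sq_gaussianReal, one_mul, mul_zero, add_zero] at h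
  have := h.const_mul (1 / Real.sqrt n)
  rwa [div_pow, one_pow, Real.sq_sqrt (Nat.cast_nonneg n)] at this

/-- A normalized entry times a bounded function that does not see it. -/
lemma meanSqLe_entry_mul_bounded (hA : IsGaussianDisorder P A) {i j : Fin n} (hij : i ≠ j)
    {F : (Fin n → Fin n → ℝ) → ℝ} (hF : Measurable F) (hFe : ∀ B, F (eraseEntry i j B) = F B)
    {b : ℝ} (hb : ∀ B, |F B| ≤ b) :
    MeanSqLe P (fun ω => 1 / Real.sqrt n * (A ω i j * F (A ω))) (1 / n * b ^ 2) := by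
  have h := (hA.meanSqLe_entry_mul hij measurable_id (integrable_pow_gaussianReal 2) hF hFe
    (MeanSqLe.of_abs_le (hF.comp hA.measurable) fun ω => hb (A ω))).const_mul (1 / Real.sqrt n)
  simpa only [id, integral_sq_gaussianReal, one_mul, div_pow, one_pow,
    Real.sq_sqrt (Nat.cast_nonneg n)] using h

/-- Removing one more vertex moves the cavity iteration by `O(n^{-1/2})`. -/
lemma meanSqLe_cavity_insert (hA : IsGaussianDisorder P A) (hf : ∀ k, RegularWith (f k) (M k))
    (u : Fin n → ℝ) (k : ℕ) {S : Finset (Fin n)} {i l : Fin n} (hl : l ∉ S) (hli : l ≠ i) :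
    MeanSqLe P (fun ω => cavity f (A ω) u k S l - cavity f (A ω) u k (S ∪ {i}) l)
      (insertConst M k / n) := by
  by_cases hi : i ∈ S
  · have hSi : S ∪ {i} = S := by simpa using hi
    simp only [hSi, sub_self]
    exact MeanSqLe.zero.weaken (div_nonneg (insertConst_nonneg M k) (Nat.cast_nonneg n))
  induction k generalizing S l with
  | zero => simpa [cavity, insertConst] using MeanSqLe.zero
  | succ k ih =>
    have hf' := fun k => (hf k).measurable
    have hn : (n : ℝ) ≠ 0 := by
      have := l.pos
      exact_mod_cast this.ne'
    have hset : Finset.univ \ (S ∪ {l}) = insert i (Finset.univ \ (S ∪ {i} ∪ {l})) := by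
      ext p
      simp only [Finset.mem_sdiff, Finset.mem_univ, true_and, Finset.mem_union,
        Finset.mem_singleton, Finset.mem_insert]
      by_cases hp : p = i
      · subst hp; simp [hi, hli.symm]
      · simp [hp]
    have h1 := hA.meanSqLe_entry_mul_bounded hli
      (F := fun B => f k (cavity f B u k (S ∪ {l}) i))
      ((hf' k).comp (CavityAMP.measurable_cavity hf' u k _ i))
      (fun B => by rw [cavity_eraseEntry u k (by simp) (by simp [hi, hli.symm])])
      (fun B => (hf k).bound _)
    have h2 := hA.meanSqLe_row_sum (i := l) (s := Finset.univ \ (S ∪ {i} ∪ {l})) (by simp)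
      (Y := fun j B => f k (cavity f B u k (S ∪ {l}) j) - f k (cavity f B u k (S ∪ {l} ∪ {i}) j))
      (b := M k + M k) (α := fun _ => M k ^ 2 * (insertConst M k / n))
      (fun j _ => ((hf' k).comp (CavityAMP.measurable_cavity hf' u k _ j)).sub
        ((hf' k).comp (CavityAMP.measurable_cavity hf' u k _ j)))
      (fun j _ B => (abs_sub _ _).trans (add_le_add ((hf k).bound _) ((hf k).bound _)))
      (fun j hj j' hj' B => by
        simp only [Finset.mem_sdiff, Finset.mem_univ, true_and, Finset.mem_union,
          Finset.mem_singleton, not_or] at hj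
        rw [cavity_eraseEntry u k (by simp) (by simp [hj]),
          cavity_eraseEntry u k (by simp) (by simp [hj])])
      (fun j hj => by
        simp only [Finset.mem_sdiff, Finset.mem_univ, true_and, Finset.mem_union,
          Finset.mem_singleton, not_or] at hj
        refine (ih (S := S ∪ {l}) (l := j) (by simp [hj]) hj.1.2
          (by simp [hi, hli.symm])).dominated ?_ (M k) (fun ω => (hf k).lipschitz _ _)
        exact ((hf' k).comp (hA.measurable_cavity hf u k _ j)).sub
          ((hf' k).comp (hA.measurable_cavity hf u k _ j)))
    have h3 := h1.add h2
    have hrw : (fun ω => cavity f (A ω) u (k + 1) S l - cavity f (A ω) u (k + 1) (S ∪ {i}) l) =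
        fun ω => 1 / Real.sqrt n * (A ω l i * f k (cavity f (A ω) u k (S ∪ {l}) i)) +
          1 / Real.sqrt n * ∑ j ∈ Finset.univ \ (S ∪ {i} ∪ {l}), A ω l j *
            (f k (cavity f (A ω) u k (S ∪ {l}) j) -
              f k (cavity f (A ω) u k (S ∪ {l} ∪ {i}) j)) := by
      funext ω
      rw [cavity_succ, cavity_succ, hset, Finset.sum_insert (by simp),
        Finset.union_right_comm S {i} {l}]
      simp only [mul_sub, Finset.sum_sub_distrib]
      ring
    rw [hrw]
    refine h3.weaken ?_
    have hcard : ((Finset.univ \ (S ∪ {i} ∪ {l}) : Finset (Fin n)).card : ℝ) ≤ n := by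
      exact_mod_cast (card_finset_fin_le _)
    have hc := insertConst_nonneg M k
    have hn0 : (0 : ℝ) ≤ n := Nat.cast_nonneg n
    have hnn : 0 ≤ M k ^ 2 * (insertConst M k / n) := by positivity
    rw [Finset.sum_const, nsmul_eq_mul, insertConst]
    calc 2 * (1 / (n : ℝ) * M k ^ 2) + 2 * (1 / (n : ℝ) *
          (((Finset.univ \ (S ∪ {i} ∪ {l}) : Finset (Fin n)).card : ℝ) *
            (M k ^ 2 * (insertConst M k / n))))
        ≤ 2 * (1 / (n : ℝ) * M k ^ 2) + 2 * (1 / (n : ℝ) *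
          ((n : ℝ) * (M k ^ 2 * (insertConst M k / n)))) := by gcongr
      _ = _ := by field_simp

/-- The entry `(i, j)` has influence `O(n^{-1/2})` on the cavity iteration at `i` and `j`, and
`O(n^{-1})` elsewhere. -/
lemma meanSqLe_cavity_influence (hA : IsGaussianDisorder P A)
    (hf : ∀ k, RegularWith (f k) (M k)) (u : Fin n → ℝ) (k : ℕ) {S : Finset (Fin n)}
    {i j l : Fin n} (hij : i ≠ j) (hl : l ∉ S) :
    MeanSqLe P (fun ω => cavity f (A ω) u k S l - cavity f (eraseEntry i j (A ω)) u k S l)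
      (influenceConst M k * if l = i ∨ l = j then 1 / (n : ℝ) else 1 / (n : ℝ) ^ 2) := by
  have hf' := fun k => (hf k).measurable
  have hnn : 0 ≤ influenceConst M k *
      if l = i ∨ l = j then 1 / (n : ℝ) else 1 / (n : ℝ) ^ 2 :=
    mul_nonneg (influenceConst_nonneg M k) (by split_ifs <;> positivity)
  cases k with
  | zero => simpa [cavity, influenceConst] using MeanSqLe.zero
  | succ k =>
  have hc := influenceConst_nonneg M k
  -- At an end point of the erased entry exactly one term of the row sum changes.
  have hend : ∀ a b : Fin n, a ≠ b → a ∉ S → MeanSqLe P (fun ω => cavity f (A ω) u (k + 1) S a -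
      cavity f (eraseEntry a b (A ω)) u (k + 1) S a) (influenceConst M (k + 1) * (1 / n)) := by
    intro a b hab ha
    by_cases hb : b ∈ S
    · simp only [cavity_eraseEntry u (k + 1) (Or.inr hb) ha, sub_self]
      refine MeanSqLe.zero.weaken ?_
      exact mul_nonneg (influenceConst_nonneg M (k + 1)) (by positivity)
    · simp only [cavity_sub_cavity_eraseEntry u k hab hb]
      refine (hA.meanSqLe_entry_mul_bounded hab
        (F := fun B => f k (cavity f B u k (S ∪ {a}) b))
        ((hf' k).comp (CavityAMP.measurable_cavity hf' u k _ b))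
        (fun B => by rw [cavity_eraseEntry u k (by simp) (by simp [hb, hab.symm])])
        (fun B => (hf k).bound _)).weaken ?_
      rw [influenceConst, mul_comm]
      refine mul_le_mul_of_nonneg_right ?_ (by positivity)
      nlinarith [mul_nonneg (sq_nonneg (M k)) hc]
  by_cases hli : l = i
  · subst hli
    simpa using hend l j hij hl
  by_cases hlj : l = j
  · subst hlj
    simp only [eraseEntry_swap i l]
    simpa using hend l i (Ne.symm hij) hl
  · have hn : (n : ℝ) ≠ 0 := by
      have := l.pos
      exact_mod_cast this.ne'
    simp only [hli, hlj, or_self, if_false]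
    set ρ : Fin n → ℝ := fun p => if p = i ∨ p = j then 1 / (n : ℝ) else 1 / (n : ℝ) ^ 2 with hρ
    have h2 := hA.meanSqLe_row_sum (i := l) (s := Finset.univ \ (S ∪ {l})) (by simp)
      (Y := fun p B => f k (cavity f B u k (S ∪ {l}) p) -
        f k (cavity f (eraseEntry i j B) u k (S ∪ {l}) p))
      (b := M k + M k) (α := fun p => M k ^ 2 * (influenceConst M k * ρ p))
      (fun p _ => ((hf' k).comp (CavityAMP.measurable_cavity hf' u k _ p)).sub
        ((hf' k).comp ((CavityAMP.measurable_cavity hf' u k _ p).comp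
          (measurable_eraseEntry i j))))
      (fun p _ B => (abs_sub _ _).trans (add_le_add ((hf k).bound _) ((hf k).bound _)))
      (fun p hp p' hp' B => by
        simp only [Finset.mem_sdiff, Finset.mem_univ, true_and] at hp
        rw [eraseEntry_comm i j l p', cavity_eraseEntry u k (by simp) hp,
          cavity_eraseEntry u k (by simp) hp])
      (fun p hp => by
        simp only [Finset.mem_sdiff, Finset.mem_univ, true_and] at hp
        refine (meanSqLe_cavity_influence hA hf u k hij hp).dominated ?_ (M k)
          (fun ω => (hf k).lipschitz _ _)
        exact ((hf' k).comp (hA.measurable_cavity hf u k _ p)).sub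
          ((hf' k).comp ((CavityAMP.measurable_cavity hf' u k _ p).comp
            ((measurable_eraseEntry i j).comp hA.measurable))))
    have hrw : (fun ω => cavity f (A ω) u (k + 1) S l -
        cavity f (eraseEntry i j (A ω)) u (k + 1) S l) =
        fun ω => 1 / Real.sqrt n * ∑ p ∈ Finset.univ \ (S ∪ {l}), A ω l p *
            (f k (cavity f (A ω) u k (S ∪ {l}) p) -
              f k (cavity f (eraseEntry i j (A ω)) u k (S ∪ {l}) p)) := by
      funext ω
      rw [cavity_succ, cavity_succ, ← mul_sub, ← Finset.sum_sub_distrib]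
      congr 1
      refine Finset.sum_congr rfl fun p _ => ?_
      rw [eraseEntry_of_ne _ (fun h => hli h.1) (fun h => hlj h.1), mul_sub]
    rw [hrw]
    refine h2.weaken ?_
    have hρ0 : ∀ p, 0 ≤ ρ p := fun p => by simp only [hρ]; split_ifs <;> positivity
    have hsum : ∑ p ∈ Finset.univ \ (S ∪ {l}), ρ p ≤ 3 / n := by
      calc ∑ p ∈ Finset.univ \ (S ∪ {l}), ρ p ≤ ∑ p, ρ p :=
            Finset.sum_le_sum_of_subset_of_nonneg (Finset.subset_univ _) fun p _ _ => hρ0 p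
        _ ≤ ∑ p, ((if p = i then 1 / (n : ℝ) else 0) + (if p = j then 1 / (n : ℝ) else 0) +
              1 / (n : ℝ) ^ 2) := by
            refine Finset.sum_le_sum fun p _ => ?_
            have h1 : (0 : ℝ) ≤ 1 / n := by positivity
            have h2 : (0 : ℝ) ≤ 1 / (n : ℝ) ^ 2 := by positivity
            simp only [hρ]
            split_ifs <;> first | linarith | tauto
        _ = 3 / n := by
            simp only [Finset.sum_add_distrib, Finset.sum_ite_eq', Finset.mem_univ, if_true,
              Finset.sum_const, Finset.card_univ, Fintype.card_fin, nsmul_eq_mul]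
            field_simp
            ring
    rw [← Finset.mul_sum, ← Finset.mul_sum, influenceConst]
    calc 1 / (n : ℝ) * (M k ^ 2 * (influenceConst M k * ∑ p ∈ Finset.univ \ (S ∪ {l}), ρ p))
        ≤ 1 / (n : ℝ) * (M k ^ 2 * (influenceConst M k * (3 / n))) := by gcongr
      _ = 3 * (M k ^ 2 * influenceConst M k) * (1 / (n : ℝ) ^ 2) := by field_simp
      _ ≤ _ := by
        refine mul_le_mul_of_nonneg_right ?_ (by positivity)
        linarith [sq_nonneg (M k)]

end IsGaussianDisorder

/-! ### The Onsager correction -/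

/-- The cavity value at `j` after `m + 1` steps, computed without the entry `(i, j)`. -/
noncomputable def erasedCavity {n : ℕ} (f : ℕ → ℝ → ℝ) (u : Fin n → ℝ) (m : ℕ) (i j : Fin n)
    (B : Fin n → Fin n → ℝ) : ℝ :=
  cavity f (eraseEntry i j B) u (m + 1) ∅ j

/-- The defect at `i` with which `w^{[k]} = cavity f B u k ∅` satisfies step `m + 1` of the AMP
recursion. -/
noncomputable def ampDefect {n : ℕ} (f : ℕ → ℝ → ℝ) (u : Fin n → ℝ) (m : ℕ) (i : Fin n)
    (B : Fin n → Fin n → ℝ) : ℝ :=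
  1 / Real.sqrt n * ∑ j, B i j * f (m + 1) (cavity f B u (m + 1) ∅ j)
    - (1 / n * ∑ j, deriv (f (m + 1)) (cavity f B u (m + 1) ∅ j)) * f m (cavity f B u m ∅ i)
    - cavity f B u (m + 2) ∅ i

section erasedCavity

variable {n : ℕ} {f : ℕ → ℝ → ℝ} {M : ℕ → ℝ}

lemma measurable_erasedCavity (hf : ∀ k, RegularWith (f k) (M k)) (u : Fin n → ℝ) (m : ℕ)
    (i j : Fin n) : Measurable fun B : Fin n → Fin n → ℝ => erasedCavity f u m i j B :=
  (CavityAMP.measurable_cavity (fun k => (hf k).measurable) u (m + 1) ∅ j).comp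
    (measurable_eraseEntry i j)

lemma erasedCavity_eraseEntry (u : Fin n → ℝ) (m : ℕ) (i j : Fin n) (B : Fin n → Fin n → ℝ) :
    erasedCavity f u m i j (eraseEntry i j B) = erasedCavity f u m i j B := by
  simp only [erasedCavity, eraseEntry_idem]

lemma cavity_sub_erasedCavity (u : Fin n → ℝ) (m : ℕ) {i j : Fin n} (hij : i ≠ j)
    (B : Fin n → Fin n → ℝ) :
    cavity f B u (m + 1) ∅ j - erasedCavity f u m i j B =
      1 / Real.sqrt n * (B j i * f m (cavity f B u m {j} i)) := by
  rw [erasedCavity, eraseEntry_swap, cavity_sub_cavity_eraseEntry u m hij.symm (by simp),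
    Finset.empty_union]

end erasedCavity

namespace IsGaussianDisorder

variable {Ω : Type*} [MeasurableSpace Ω] {n : ℕ} {P : Measure Ω} [IsProbabilityMeasure P]
  {A : Ω → Fin n → Fin n → ℝ} {f : ℕ → ℝ → ℝ} {M : ℕ → ℝ}

lemma meanSqLe_cavity_sub_erasedCavity (hA : IsGaussianDisorder P A)
    (hf : ∀ k, RegularWith (f k) (M k)) (u : Fin n → ℝ) (m : ℕ) {i j : Fin n} (hij : i ≠ j) :
    MeanSqLe P (fun ω => cavity f (A ω) u (m + 1) ∅ j - erasedCavity f u m i j (A ω))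
      (M m ^ 2 / n) := by
  simp only [cavity_sub_erasedCavity u m hij]
  have hf' := fun k => (hf k).measurable
  refine (hA.meanSqLe_entry_mul_bounded hij.symm
    (F := fun B => f m (cavity f B u m {j} i))
    ((hf' m).comp (CavityAMP.measurable_cavity hf' u m _ i))
    (fun B => by rw [cavity_eraseEntry u m (by simp) (by simpa using hij)])
    (fun B => (hf m).bound _)).weaken (le_of_eq (by ring))

/-- The entry `(i, j')` influences the value at `j` without `(i, j)` by `O(n^{-1})`: through the
value at `j` itself, and through the one erased term. -/
lemma meanSqLe_erasedCavity_influence (hA : IsGaussianDisorder P A)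
    (hf : ∀ k, RegularWith (f k) (M k)) (u : Fin n → ℝ) (m : ℕ) {i j j' : Fin n} (hij : i ≠ j)
    (hij' : i ≠ j') (hjj : j ≠ j') :
    MeanSqLe P
      (fun ω => erasedCavity f u m i j (A ω) - erasedCavity f u m i j (eraseEntry i j' (A ω)))
      ((2 * influenceConst M (m + 1) + 2 * (M m ^ 2 * influenceConst M m)) / (n : ℝ) ^ 2) := by
  have hf' := fun k => (hf k).measurable
  have h1 := hA.meanSqLe_cavity_influence hf u (m + 1) (S := ∅) hij' (l := j) (by simp)
  have h2 := hA.meanSqLe_cavity_influence hf u m (S := {j}) hij' (l := i) (by simpa using hij)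
  simp only [hij.symm, hjj, or_self, if_false] at h1
  simp only [true_or, if_true] at h2
  have h3 := h2.dominated (Y := fun ω => f m (cavity f (A ω) u m {j} i) -
    f m (cavity f (eraseEntry i j' (A ω)) u m {j} i))
    (((hf' m).comp (hA.measurable_cavity hf u m _ i)).sub
      ((hf' m).comp ((CavityAMP.measurable_cavity hf' u m _ i).comp
        ((measurable_eraseEntry i j').comp hA.measurable)))) (M m) (fun ω => (hf m).lipschitz _ _)
  have h4 := (hA.meanSqLe_entry_mul hij.symm measurable_id (integrable_pow_gaussianReal 2)
    (F := fun B => f m (cavity f B u m {j} i) - f m (cavity f (eraseEntry i j' B) u m {j} i))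
    (((hf' m).comp (CavityAMP.measurable_cavity hf' u m _ i)).sub
      ((hf' m).comp ((CavityAMP.measurable_cavity hf' u m _ i).comp
        (measurable_eraseEntry i j'))))
    (fun B => by
      rw [eraseEntry_comm i j' j i, cavity_eraseEntry u m (by simp) (by simpa using hij),
        cavity_eraseEntry u m (by simp) (by simpa using hij)]) h3).const_mul (1 / Real.sqrt n)
  simp only [id, integral_sq_gaussianReal, one_mul, div_pow, one_pow,
    Real.sq_sqrt (Nat.cast_nonneg n)] at h4
  have h5 := h1.sub h4
  have hrw : (fun ω => erasedCavity f u m i j (A ω) -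
      erasedCavity f u m i j (eraseEntry i j' (A ω))) = fun ω =>
      (cavity f (A ω) u (m + 1) ∅ j - cavity f (eraseEntry i j' (A ω)) u (m + 1) ∅ j) -
        1 / Real.sqrt n * (A ω j i * (f m (cavity f (A ω) u m {j} i) -
          f m (cavity f (eraseEntry i j' (A ω)) u m {j} i))) := by
    funext ω
    have e1 := cavity_sub_erasedCavity (f := f) u m hij (A ω)
    have e2 := cavity_sub_erasedCavity (f := f) u m hij (eraseEntry i j' (A ω))
    rw [eraseEntry_of_ne _ (fun h => hij h.1.symm) (fun h => hjj h.1)] at e2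
    linear_combination e2 - e1
  rw [hrw]
  exact h5.weaken (le_of_eq (by ring))

/-- The contribution of the cross terms: the row sum of `f (m + 1)` at the erased values differs
from the cavity row sum by `O(n^{-1/2})`. -/
lemma meanSqLe_row_sum_erasedCavity_sub (hA : IsGaussianDisorder P A)
    (hf : ∀ k, RegularWith (f k) (M k)) (u : Fin n → ℝ) (m : ℕ) (i : Fin n) :
    MeanSqLe P (fun ω => 1 / Real.sqrt n * ∑ j ∈ Finset.univ \ {i}, A ω i j *
        (f (m + 1) (erasedCavity f u m i j (A ω)) - f (m + 1) (cavity f (A ω) u (m + 1) {i} j)))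
      (M (m + 1) ^ 2 * (2 * M m ^ 2 + 2 * insertConst M (m + 1) + 2 * influenceConst M (m + 1) +
        2 * (M m ^ 2 * influenceConst M m)) / n) := by
  have hf' := fun k => (hf k).measurable
  have hn : (0 : ℝ) < n := by exact_mod_cast i.pos
  have hI := influenceConst_nonneg M m
  have hI' := influenceConst_nonneg M (m + 1)
  have hmY : ∀ j, Measurable fun B => f (m + 1) (erasedCavity f u m i j B) -
      f (m + 1) (cavity f B u (m + 1) {i} j) := fun j =>
    ((hf' (m + 1)).comp (measurable_erasedCavity hf u m i j)).sub
      ((hf' (m + 1)).comp (CavityAMP.measurable_cavity hf' u (m + 1) _ j))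
  have h := hA.meanSqLe_sum_entry_mul (i := i) (s := Finset.univ \ {i}) (by simp) measurable_id
    (integrable_pow_gaussianReal 2) integral_id_gaussianReal
    (Y := fun j B => f (m + 1) (erasedCavity f u m i j B) - f (m + 1) (cavity f B u (m + 1) {i} j))
    (b := M (m + 1) + M (m + 1))
    (α := fun _ => M (m + 1) ^ 2 * ((2 * M m ^ 2 + 2 * insertConst M (m + 1)) / n))
    (β := M (m + 1) ^ 2 * ((2 * influenceConst M (m + 1) +
      2 * (M m ^ 2 * influenceConst M m)) / (n : ℝ) ^ 2))
    (fun j _ => hmY j)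
    (fun j _ B => (abs_sub _ _).trans (add_le_add ((hf _).bound _) ((hf _).bound _)))
    (fun j hj B => by
      have hj' : j ∉ ({i} : Finset (Fin n)) := by simpa using hj
      rw [erasedCavity_eraseEntry, cavity_eraseEntry u (m + 1) (by simp) hj'])
    (by positivity)
    (fun j hj => by
      have hij : i ≠ j := fun h => by simp [h] at hj
      have h1 := hA.meanSqLe_cavity_insert hf u (m + 1) (S := ∅) (i := i) (l := j) (by simp)
        hij.symm
      rw [Finset.empty_union] at h1
      have h2 := h1.sub (hA.meanSqLe_cavity_sub_erasedCavity hf u m hij)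
      refine (h2.dominated ((hmY j).comp hA.measurable) (M (m + 1)) (fun ω => ?_)).weaken
        (le_of_eq (by ring))
      refine ((hf (m + 1)).lipschitz _ _).trans (le_of_eq ?_)
      congr 2
      ring)
    (fun j hj j' hj' hjj => by
      have hij : i ≠ j := fun h => by simp [h] at hj
      have hij' : i ≠ j' := fun h => by simp [h] at hj'
      refine (hA.meanSqLe_erasedCavity_influence hf u m hij hij' hjj).dominated
        (((hmY j).comp hA.measurable).sub ((hmY j).comp
          ((measurable_eraseEntry i j').comp hA.measurable))) (M (m + 1)) (fun ω => ?_)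
      simp only [Pi.sub_apply, Function.comp]
      rw [cavity_eraseEntry u (m + 1) (by simp) (by simpa using hij.symm)]
      simpa using (hf (m + 1)).lipschitz _ _)
  simp only [id, integral_sq_gaussianReal, one_mul] at h
  refine (h.const_mul (1 / Real.sqrt n)).weaken ?_
  have hJ := insertConst_nonneg M (m + 1)
  have hcard : ((Finset.univ \ {i} : Finset (Fin n)).card : ℝ) ≤ n := by
    exact_mod_cast (card_finset_fin_le _)
  rw [div_pow, one_pow, Real.sq_sqrt hn.le, Finset.sum_const, nsmul_eq_mul]
  calc _ ≤ 1 / (n : ℝ) * (n * (M (m + 1) ^ 2 *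
        ((2 * M m ^ 2 + 2 * insertConst M (m + 1)) / n)) +
        n ^ 2 * (M (m + 1) ^ 2 * ((2 * influenceConst M (m + 1) +
          2 * (M m ^ 2 * influenceConst M m)) / (n : ℝ) ^ 2))) := by gcongr
    _ = _ := by field_simp; ring

/-- The second-order Taylor remainder of the row sum. -/
lemma meanSqLe_taylor_remainder (hA : IsGaussianDisorder P A)
    (hf : ∀ k, RegularWith (f k) (M k)) (u : Fin n → ℝ) (m : ℕ) (i : Fin n) :
    MeanSqLe P (fun ω => 1 / Real.sqrt n * ∑ j ∈ Finset.univ \ {i}, A ω i j *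
        (f (m + 1) (cavity f (A ω) u (m + 1) ∅ j) - f (m + 1) (erasedCavity f u m i j (A ω)) -
          deriv (f (m + 1)) (erasedCavity f u m i j (A ω)) *
            (cavity f (A ω) u (m + 1) ∅ j - erasedCavity f u m i j (A ω))))
      ((M (m + 1) * M m ^ 2) ^ 2 * (∫ x, (x ^ 3) ^ 2 ∂gaussianReal 0 1) / n) := by
  have hf' := fun k => (hf k).measurable
  have hn : (0 : ℝ) < n := by exact_mod_cast i.pos
  have hs : 0 < Real.sqrt n := Real.sqrt_pos.mpr hn
  have hmw : ∀ j, Measurable fun ω => cavity f (A ω) u (m + 1) ∅ j := fun j =>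
    hA.measurable_cavity hf u (m + 1) ∅ j
  have hme : ∀ j, Measurable fun ω => erasedCavity f u m i j (A ω) := fun j =>
    (measurable_erasedCavity hf u m i j).comp hA.measurable
  have hterm : ∀ j ∈ Finset.univ \ {i}, MeanSqLe P (fun ω => n * (1 / Real.sqrt n * (A ω i j *
        (f (m + 1) (cavity f (A ω) u (m + 1) ∅ j) - f (m + 1) (erasedCavity f u m i j (A ω)) -
          deriv (f (m + 1)) (erasedCavity f u m i j (A ω)) *
            (cavity f (A ω) u (m + 1) ∅ j - erasedCavity f u m i j (A ω))))))
      ((M (m + 1) * M m ^ 2) ^ 2 * (∫ x, (x ^ 3) ^ 2 ∂gaussianReal 0 1) / n) := by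
    intro j hj
    have hij : i ≠ j := fun h => by simp [h] at hj
    have h6 : Integrable (fun x : ℝ => (x ^ 3) ^ 2) (gaussianReal 0 1) := by
      simpa only [← pow_mul] using integrable_pow_gaussianReal 6
    have h1 := hA.meanSqLe_entry_mul hij (φ := fun x => x ^ 3) (by fun_prop) h6 (F := fun _ => 1)
      measurable_const (fun _ => rfl) (MeanSqLe.of_abs_le (b := 1) measurable_const (by simp))
    refine (h1.dominated ?_ (M (m + 1) * M m ^ 2 / Real.sqrt n) fun ω => ?_).weaken
      (le_of_eq ?_)
    · exact ((((hA.measurable_entry i j).mul ((((hf' _).comp (hmw j)).sub ((hf' _).comp (hme j))).sub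
        (((hf _).measurable_deriv.comp (hme j)).mul ((hmw j).sub (hme j)))))).const_mul _).const_mul
          _
    · have hD := cavity_sub_erasedCavity (f := f) u m hij (A ω)
      have ht := (hf (m + 1)).taylor (erasedCavity f u m i j (A ω))
        (cavity f (A ω) u (m + 1) ∅ j - erasedCavity f u m i j (A ω))
      rw [add_sub_cancel] at ht
      have hD2 : (cavity f (A ω) u (m + 1) ∅ j - erasedCavity f u m i j (A ω)) ^ 2 ≤
          1 / n * (A ω i j ^ 2 * M m ^ 2) := by
        rw [hD, mul_pow, mul_pow, div_pow, one_pow, Real.sq_sqrt hn.le, hA.symm ω j i]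
        gcongr ?_ * (?_ * ?_)
        rw [← sq_abs]
        gcongr
        exact (hf m).bound _
      have hM := (hf (m + 1)).nonneg
      simp only [abs_mul, abs_div, abs_one, mul_one, abs_pow]
      rw [abs_of_pos hs, abs_of_pos hn]
      calc _ ≤ n * (1 / Real.sqrt n * (|A ω i j| * (M (m + 1) *
            (1 / n * (A ω i j ^ 2 * M m ^ 2))))) := by
            gcongr
            exact ht.trans (by gcongr)
        _ = _ := by
            rw [← sq_abs (A ω i j)]
            field_simp
    · rw [div_pow, Real.sq_sqrt hn.le]
      ring
  have := MeanSqLe.average (c := (M (m + 1) * M m ^ 2) ^ 2 *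
    (∫ x, (x ^ 3) ^ 2 ∂gaussianReal 0 1) / n) (Finset.univ \ {i}) (by positivity) hterm
  simp only [← Finset.mul_sum] at this
  simpa only [one_div, ← mul_assoc, inv_mul_cancel₀ hn.ne', one_mul] using this

/-- The fluctuation of the squared entries in the first-order Taylor term. -/
lemma meanSqLe_sq_entry_fluctuation (hA : IsGaussianDisorder P A)
    (hf : ∀ k, RegularWith (f k) (M k)) (u : Fin n → ℝ) (m : ℕ) (i : Fin n) :
    MeanSqLe P (fun ω => 1 / (n : ℝ) * ∑ j ∈ Finset.univ \ {i}, (A ω i j ^ 2 - 1) *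
        (deriv (f (m + 1)) (erasedCavity f u m i j (A ω)) * f m (cavity f (A ω) u m {j} i)))
      ((∫ x, (x ^ 2 - 1) ^ 2 ∂gaussianReal 0 1) * ((M (m + 1) * M m) ^ 2 *
        (1 + 2 * influenceConst M m + 2 * (2 * influenceConst M (m + 1) +
          2 * (M m ^ 2 * influenceConst M m)))) / n) := by
  have hf' := fun k => (hf k).measurable
  have hn : (0 : ℝ) < n := by exact_mod_cast i.pos
  have hI := influenceConst_nonneg M m
  have hI' := influenceConst_nonneg M (m + 1)
  have hL := (hf m).nonneg
  have hK := (hf (m + 1)).nonneg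
  set κ := 2 * influenceConst M (m + 1) + 2 * (M m ^ 2 * influenceConst M m) with hκ
  have hκ0 : 0 ≤ κ := by positivity
  have hmd : ∀ j, Measurable fun B => deriv (f (m + 1)) (erasedCavity f u m i j B) := fun j =>
    (hf (m + 1)).measurable_deriv.comp (measurable_erasedCavity hf u m i j)
  have hmv : ∀ j, Measurable fun B => f m (cavity f B u m {j} i) := fun j =>
    (hf' m).comp (CavityAMP.measurable_cavity hf' u m _ i)
  have hYb : ∀ j B, |deriv (f (m + 1)) (erasedCavity f u m i j B) * f m (cavity f B u m {j} i)| ≤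
      M (m + 1) * M m := fun j B => by
    rw [abs_mul]
    exact mul_le_mul ((hf _).deriv_bound _) ((hf _).bound _) (abs_nonneg _) hK
  have h4 : Integrable (fun x : ℝ => (x ^ 2 - 1) ^ 2) (gaussianReal 0 1) := by
    have := ((integrable_pow_gaussianReal 4).sub
      ((integrable_pow_gaussianReal 2).const_mul 2)).add (integrable_const 1)
    refine this.congr (Filter.Eventually.of_forall fun x => ?_)
    simp only [Pi.add_apply, Pi.sub_apply]
    ring
  have h0 : ∫ x, (x ^ 2 - 1 : ℝ) ∂gaussianReal 0 1 = 0 := by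
    rw [integral_sub (integrable_pow_gaussianReal 2) (integrable_const 1),
      integral_sq_gaussianReal]
    simp
  have h := hA.meanSqLe_sum_entry_mul (i := i) (s := Finset.univ \ {i}) (by simp)
    (φ := fun x => x ^ 2 - 1) (by fun_prop) h4 h0
    (Y := fun j B => deriv (f (m + 1)) (erasedCavity f u m i j B) * f m (cavity f B u m {j} i))
    (b := M (m + 1) * M m)
    (α := fun _ => (M (m + 1) * M m) ^ 2)
    (β := (M (m + 1) * M m) ^ 2 * (2 * influenceConst M m + 2 * κ) / n)
    (fun j _ => (hmd j).mul (hmv j)) (fun j _ => hYb j)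
    (fun j hj B => by
      have hij : i ≠ j := fun h => by simp [h] at hj
      rw [erasedCavity_eraseEntry, cavity_eraseEntry u m (by simp) (by simpa using hij)])
    (by positivity)
    (fun j _ => MeanSqLe.of_abs_le (((hmd j).mul (hmv j)).comp hA.measurable)
      fun ω => hYb j (A ω))
    (fun j hj j' hj' hjj => by
      have hij : i ≠ j := fun h => by simp [h] at hj
      have hij' : i ≠ j' := fun h => by simp [h] at hj'
      have hmdA := (hmd j).comp hA.measurable
      have hmdA' := (hmd j).comp ((measurable_eraseEntry i j').comp hA.measurable)
      have hmvA := (hmv j).comp hA.measurable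
      have hmvA' := (hmv j).comp ((measurable_eraseEntry i j').comp hA.measurable)
      have h1 := (hA.meanSqLe_cavity_influence hf u m (S := {j}) hij' (l := i)
        (by simpa using hij)).dominated (Y := fun ω =>
          deriv (f (m + 1)) (erasedCavity f u m i j (A ω)) * (f m (cavity f (A ω) u m {j} i) -
            f m (cavity f (eraseEntry i j' (A ω)) u m {j} i))) (hmdA.mul (hmvA.sub hmvA'))
        (M (m + 1) * M m) (fun ω => by
          rw [abs_mul, mul_assoc]
          exact mul_le_mul ((hf _).deriv_bound _) ((hf _).lipschitz _ _) (abs_nonneg _) hK)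
      have h2 := (hA.meanSqLe_erasedCavity_influence hf u m hij hij' hjj).dominated (Y := fun ω =>
          (deriv (f (m + 1)) (erasedCavity f u m i j (A ω)) -
            deriv (f (m + 1)) (erasedCavity f u m i j (eraseEntry i j' (A ω)))) *
            f m (cavity f (eraseEntry i j' (A ω)) u m {j} i)) ((hmdA.sub hmdA').mul hmvA')
        (M (m + 1) * M m) (fun ω => by
          rw [abs_mul, mul_right_comm]
          exact mul_le_mul ((hf _).deriv_lipschitz _ _) ((hf _).bound _) (abs_nonneg _)
            (mul_nonneg hK (abs_nonneg _)))
      have h3 := h1.add h2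
      simp only [true_or, if_true, ← hκ] at h3
      have hrw : (fun ω => deriv (f (m + 1)) (erasedCavity f u m i j (A ω)) *
            f m (cavity f (A ω) u m {j} i) -
          deriv (f (m + 1)) (erasedCavity f u m i j (eraseEntry i j' (A ω))) *
            f m (cavity f (eraseEntry i j' (A ω)) u m {j} i)) = fun ω =>
          deriv (f (m + 1)) (erasedCavity f u m i j (A ω)) * (f m (cavity f (A ω) u m {j} i) -
            f m (cavity f (eraseEntry i j' (A ω)) u m {j} i)) +
          (deriv (f (m + 1)) (erasedCavity f u m i j (A ω)) -
            deriv (f (m + 1)) (erasedCavity f u m i j (eraseEntry i j' (A ω)))) *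
            f m (cavity f (eraseEntry i j' (A ω)) u m {j} i) := by
        funext ω; ring
      rw [hrw]
      refine h3.weaken ?_
      have hn1 : κ / (n : ℝ) ^ 2 ≤ κ / n := by
        have : (1 : ℝ) ≤ n := by exact_mod_cast i.pos
        gcongr
        nlinarith
      calc _ ≤ 2 * ((M (m + 1) * M m) ^ 2 * (influenceConst M m * (1 / n))) +
            2 * ((M (m + 1) * M m) ^ 2 * (κ / n)) := by gcongr
        _ = _ := by ring)
  refine (h.const_mul (1 / (n : ℝ))).weaken ?_
  have hcard : ((Finset.univ \ {i} : Finset (Fin n)).card : ℝ) ≤ n := by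
    exact_mod_cast (card_finset_fin_le _)
  have hv0 : 0 ≤ ∫ x, (x ^ 2 - 1 : ℝ) ^ 2 ∂gaussianReal 0 1 := integral_nonneg fun x => sq_nonneg _
  rw [Finset.sum_const, nsmul_eq_mul]
  calc _ ≤ (1 / (n : ℝ)) ^ 2 * ((∫ x, (x ^ 2 - 1 : ℝ) ^ 2 ∂gaussianReal 0 1) *
        (n * (M (m + 1) * M m) ^ 2 +
          n ^ 2 * ((M (m + 1) * M m) ^ 2 * (2 * influenceConst M m + 2 * κ) / n))) := by gcongr
    _ = _ := by field_simp; ring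

/-- Averages with the weights `f' (w_j)` computed without `(i, j)`: restoring the vertex `j` in
`f (w_i)`. -/
lemma meanSqLe_average_insert (hA : IsGaussianDisorder P A)
    (hf : ∀ k, RegularWith (f k) (M k)) (u : Fin n → ℝ) (m : ℕ) (i : Fin n) :
    MeanSqLe P (fun ω => 1 / (n : ℝ) * ∑ j ∈ Finset.univ \ {i},
        deriv (f (m + 1)) (erasedCavity f u m i j (A ω)) *
          (f m (cavity f (A ω) u m {j} i) - f m (cavity f (A ω) u m ∅ i)))
      ((M (m + 1) * M m) ^ 2 * insertConst M m / n) := by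
  have hJ := insertConst_nonneg M m
  have hK := (hf (m + 1)).nonneg
  refine MeanSqLe.average _ (by positivity) fun j hj => ?_
  have hij : i ≠ j := fun h => by simp [h] at hj
  have h1 := hA.meanSqLe_cavity_insert hf u m (S := ∅) (i := j) (l := i) (by simp) hij
  rw [Finset.empty_union] at h1
  refine (h1.dominated ?_ (M (m + 1) * M m) fun ω => ?_).weaken (le_of_eq (by ring))
  · exact ((hf _).measurable_deriv.comp ((measurable_erasedCavity hf u m i j).comp
      hA.measurable)).mul (((hf m).measurable.comp (hA.measurable_cavity hf u m _ i)).sub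
        ((hf m).measurable.comp (hA.measurable_cavity hf u m _ i)))
  · rw [abs_mul, mul_assoc, abs_sub_comm (cavity f (A ω) u m ∅ i)]
    exact mul_le_mul ((hf _).deriv_bound _) ((hf _).lipschitz _ _) (abs_nonneg _) hK

/-- Restoring the entry `(i, j)` in the weights `f' (w_j)`. -/
lemma meanSqLe_average_deriv_sub (hA : IsGaussianDisorder P A)
    (hf : ∀ k, RegularWith (f k) (M k)) (u : Fin n → ℝ) (m : ℕ) (i : Fin n) :
    MeanSqLe P (fun ω => 1 / (n : ℝ) * ∑ j ∈ Finset.univ \ {i},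
        (deriv (f (m + 1)) (cavity f (A ω) u (m + 1) ∅ j) -
          deriv (f (m + 1)) (erasedCavity f u m i j (A ω))) * f m (cavity f (A ω) u m ∅ i))
      ((M (m + 1) * M m) ^ 2 * M m ^ 2 / n) := by
  have hK := (hf (m + 1)).nonneg
  refine MeanSqLe.average _ (by positivity) fun j hj => ?_
  have hij : i ≠ j := fun h => by simp [h] at hj
  refine ((hA.meanSqLe_cavity_sub_erasedCavity hf u m hij).dominated ?_ (M (m + 1) * M m)
    fun ω => ?_).weaken (le_of_eq (by ring))
  · exact (((hf _).measurable_deriv.comp (hA.measurable_cavity hf u (m + 1) _ j)).sub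
      ((hf _).measurable_deriv.comp ((measurable_erasedCavity hf u m i j).comp
      hA.measurable))).mul ((hf m).measurable.comp (hA.measurable_cavity hf u m _ i))
  · rw [abs_mul, mul_right_comm]
    exact mul_le_mul ((hf _).deriv_lipschitz _ _) ((hf _).bound _) (abs_nonneg _)
      (mul_nonneg hK (abs_nonneg _))

/-- The cavity iteration satisfies the AMP recursion up to a mean square error `O(n^{-1})`. -/
theorem exists_meanSqLe_ampDefect (M : ℕ → ℝ) (m : ℕ) : ∃ C : ℝ, 0 ≤ C ∧
    ∀ {Ω : Type v} [MeasurableSpace Ω] {n : ℕ} {P : Measure Ω} [IsProbabilityMeasure P]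
      {A : Ω → Fin n → Fin n → ℝ} {f : ℕ → ℝ → ℝ}, IsGaussianDisorder P A →
      (∀ k, RegularWith (f k) (M k)) → ∀ (u : Fin n → ℝ) (i : Fin n),
      MeanSqLe P (fun ω => ampDefect f u m i (A ω)) (C / n) := by
  obtain ⟨c₁, hc₁⟩ : ∃ c, c = M (m + 1) ^ 2 * (2 * M m ^ 2 + 2 * insertConst M (m + 1) +
    2 * influenceConst M (m + 1) + 2 * (M m ^ 2 * influenceConst M m)) := ⟨_, rfl⟩
  obtain ⟨c₂, hc₂⟩ : ∃ c, c = (M (m + 1) * M m ^ 2) ^ 2 *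
    (∫ x, (x ^ 3) ^ 2 ∂gaussianReal 0 1) := ⟨_, rfl⟩
  obtain ⟨c₃, hc₃⟩ : ∃ c, c = (∫ x, (x ^ 2 - 1) ^ 2 ∂gaussianReal 0 1) * ((M (m + 1) * M m) ^ 2 *
        (1 + 2 * influenceConst M m + 2 * (2 * influenceConst M (m + 1) +
          2 * (M m ^ 2 * influenceConst M m)))) := ⟨_, rfl⟩
  obtain ⟨c₄, hc₄⟩ : ∃ c, c = (M (m + 1) * M m) ^ 2 * insertConst M m := ⟨_, rfl⟩
  obtain ⟨c₅, hc₅⟩ : ∃ c, c = (M (m + 1) * M m) ^ 2 * M m ^ 2 := ⟨_, rfl⟩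
  have hI := influenceConst_nonneg M m
  have hI' := influenceConst_nonneg M (m + 1)
  have hJ := insertConst_nonneg M m
  have hJ' := insertConst_nonneg M (m + 1)
  refine ⟨2 * (2 * (2 * (2 * (2 * c₁ + 2 * c₂) + 2 * c₃) + 2 * c₄) + 2 * c₅) +
    2 * (M (m + 1) * M m) ^ 2, ?_, ?_⟩
  · have h1 : 0 ≤ c₁ := by rw [hc₁]; positivity
    have h2 : 0 ≤ c₂ := by rw [hc₂]; positivity
    have h3 : 0 ≤ c₃ := by rw [hc₃]; positivity
    have h4 : 0 ≤ c₄ := by rw [hc₄]; positivity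
    have h5 : 0 ≤ c₅ := by rw [hc₅]; positivity
    positivity
  intro Ω _ n P _ A f hA hf u i
  have hn : (0 : ℝ) < n := by exact_mod_cast i.pos
  have hn1 : (1 : ℝ) ≤ n := by exact_mod_cast i.pos
  have t1 := hA.meanSqLe_row_sum_erasedCavity_sub hf u m i
  have t2 := hA.meanSqLe_taylor_remainder hf u m i
  have t3 := hA.meanSqLe_sq_entry_fluctuation hf u m i
  have t4 := hA.meanSqLe_average_insert hf u m i
  have t5 := hA.meanSqLe_average_deriv_sub hf u m i
  rw [← hc₁] at t1
  rw [← hc₂] at t2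
  rw [← hc₃] at t3
  rw [← hc₄] at t4
  rw [← hc₅] at t5
  have t6 : MeanSqLe P (fun ω => 1 / (n : ℝ) * (deriv (f (m + 1)) (cavity f (A ω) u (m + 1) ∅ i) *
      f m (cavity f (A ω) u m ∅ i))) ((1 / (n : ℝ)) ^ 2 * (M (m + 1) * M m) ^ 2) := by
    refine (MeanSqLe.of_abs_le ?_ fun ω => ?_).const_mul _
    · exact ((hf _).measurable_deriv.comp (hA.measurable_cavity hf u (m + 1) _ i)).mul
        ((hf m).measurable.comp (hA.measurable_cavity hf u m _ i))
    · rw [abs_mul]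
      exact mul_le_mul ((hf _).deriv_bound _) ((hf _).bound _) (abs_nonneg _) (hf _).nonneg
  have h := ((((t1.add t2).add t3).add t4).sub t5).sub t6
  have h' : MeanSqLe P (fun ω => ampDefect f u m i (A ω))
      (2 * (2 * (2 * (2 * (2 * (c₁ / n) + 2 * (c₂ / n)) + 2 * (c₃ / n)) + 2 * (c₄ / n)) +
        2 * (c₅ / n)) + 2 * ((1 / (n : ℝ)) ^ 2 * (M (m + 1) * M m) ^ 2)) := by
    convert! h using 2 with ω
    have hc : 1 / Real.sqrt n * (1 / Real.sqrt n) = 1 / (n : ℝ) := by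
      rw [div_mul_div_comm, one_mul, Real.mul_self_sqrt hn.le]
    rw [ampDefect, cavity_succ (A ω) u (m + 1) ∅ i, Finset.empty_union,
      ← Finset.sum_sdiff (Finset.subset_univ ({i} : Finset (Fin n))),
      ← Finset.sum_sdiff (Finset.subset_univ ({i} : Finset (Fin n))),
      Finset.sum_singleton, Finset.sum_singleton, hA.diag, zero_mul, add_zero, mul_add, add_mul,
      ← sub_sub, sub_right_comm, mul_assoc _ (deriv _ _)]
    congr 1
    simp only [Finset.mul_sum, Finset.sum_mul, ← Finset.sum_add_distrib,
      ← Finset.sum_sub_distrib]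
    refine Finset.sum_congr rfl fun j hj => ?_
    have hij : i ≠ j := fun h => by simp [h] at hj
    have hD := cavity_sub_erasedCavity (f := f) u m hij (A ω)
    rw [hA.symm ω j i] at hD
    linear_combination 1 / Real.sqrt n * A ω i j *
      deriv (f (m + 1)) (erasedCavity f u m i j (A ω)) * hD + A ω i j ^ 2 *
      deriv (f (m + 1)) (erasedCavity f u m i j (A ω)) * f m (cavity f (A ω) u m {j} i) * hc
  refine h'.weaken ?_
  have hle : (1 / (n : ℝ)) ^ 2 * (M (m + 1) * M m) ^ 2 ≤ 1 / n * (M (m + 1) * M m) ^ 2 := by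
    refine mul_le_mul_of_nonneg_right ?_ (sq_nonneg _)
    rw [sq]
    exact mul_le_of_le_one_left (by positivity) ((div_le_one hn).mpr hn1)
  calc _ ≤ 2 * (2 * (2 * (2 * (2 * (c₁ / n) + 2 * (c₂ / n)) + 2 * (c₃ / n)) + 2 * (c₄ / n)) +
        2 * (c₅ / n)) + 2 * (1 / n * (M (m + 1) * M m) ^ 2) := by gcongr
    _ = _ := by ring

end IsGaussianDisorder

/-! ### The operator norm of the disorder -/

/-- The ball of radius `2` in `ℝⁿ` has a `1`-net of at most `5 ^ n` points. -/
lemma exists_net (n : ℕ) : ∃ N : Finset (EuclideanSpace ℝ (Fin n)), N.card ≤ 5 ^ n ∧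
    (∀ x ∈ N, ‖x‖ ≤ 2) ∧ ∀ x, ‖x‖ ≤ 2 → ∃ y ∈ N, ‖x - y‖ ≤ 1 := by
  classical
  -- A separated set of maximal cardinality is a net.
  let Sep : Set (Finset (EuclideanSpace ℝ (Fin n))) :=
    {s | (∀ c ∈ s, ‖c‖ ≤ 2) ∧ ∀ c ∈ s, ∀ d ∈ s, c ≠ d → 1 ≤ ‖c - d‖}
  have hcard : ∀ s ∈ Sep, s.card ≤ 5 ^ n := fun s hs => by
    simpa using Besicovitch.card_le_of_separated s hs.1 hs.2
  have hbdd : BddAbove (Finset.card '' Sep) := ⟨5 ^ n, by rintro _ ⟨s, hs, rfl⟩; exact hcard s hs⟩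
  have hne : (Finset.card '' Sep).Nonempty := ⟨_, ∅, by simp [Sep], rfl⟩
  obtain ⟨N, hN, hmax⟩ := Nat.sSup_mem hne hbdd
  refine ⟨N, hcard N hN, hN.1, fun x hx => ?_⟩
  by_contra! hfar
  have hxN : x ∉ N := fun h => by
    have := hfar x h
    simp at this
    linarith
  have hins : insert x N ∈ Sep := by
    refine ⟨fun c hc => ?_, fun c hc d hd hcd => ?_⟩
    · rcases Finset.mem_insert.mp hc with rfl | hc
      · exact hx
      · exact hN.1 c hc
    · rcases Finset.mem_insert.mp hc with hcx | hcN <;> rcases Finset.mem_insert.mp hd with hdx | hdN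
      · exact absurd (hcx.trans hdx.symm) hcd
      · rw [hcx]; exact (hfar d hdN).le
      · rw [hdx, norm_sub_rev]; exact (hfar c hcN).le
      · exact hN.2 c hcN d hdN hcd
  have := le_csSup hbdd ⟨_, hins, rfl⟩
  rw [← hmax, Finset.card_insert_of_notMem hxN] at this
  omega

/-- A bilinear form bounded on a net of the ball of radius `2` is bounded in operator norm. -/
lemma norm_le_of_net {E : Type*} [NormedAddCommGroup E] [InnerProductSpace ℝ E] {N : Finset E}
    (hN : ∀ x, ‖x‖ ≤ 2 → ∃ y ∈ N, ‖x - y‖ ≤ 1) (T : E →L[ℝ] E) {c : ℝ} (hc : 0 ≤ c)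
    (h : ∀ x ∈ N, ∀ y ∈ N, inner ℝ y (T x) ≤ c) : ‖T‖ ≤ c := by
  have h1 : ∀ x ∈ N, ‖T x‖ ≤ c := by
    intro x hx
    rcases eq_or_ne (T x) 0 with h0 | h0
    · simpa [h0] using hc
    have hpos : 0 < ‖T x‖ := norm_pos_iff.mpr h0
    obtain ⟨y, hy, hxy⟩ := hN ((2 / ‖T x‖) • T x) (by
      rw [norm_smul, norm_div, norm_norm, Real.norm_two, div_mul_cancel₀ _ hpos.ne'])
    have e1 : inner ℝ ((2 / ‖T x‖) • T x) (T x) = 2 * ‖T x‖ := by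
      rw [real_inner_smul_left, real_inner_self_eq_norm_sq]
      field_simp
    have e2 : inner ℝ ((2 / ‖T x‖) • T x - y) (T x) ≤ 1 * ‖T x‖ :=
      (real_inner_le_norm _ _).trans (mul_le_mul_of_nonneg_right hxy hpos.le)
    rw [inner_sub_left, e1] at e2
    linarith [h x hx y hy]
  have h2 : ‖T‖ ≤ (c + ‖T‖) / 2 := by
    refine T.opNorm_le_bound (by positivity) fun x => ?_
    rcases eq_or_ne x 0 with rfl | h0
    · simp
    have hpos : 0 < ‖x‖ := norm_pos_iff.mpr h0
    obtain ⟨y, hy, hxy⟩ := hN ((2 / ‖x‖) • x) (by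
      rw [norm_smul, norm_div, norm_norm, Real.norm_two, div_mul_cancel₀ _ hpos.ne'])
    have e1 : ‖T ((2 / ‖x‖) • x)‖ = 2 / ‖x‖ * ‖T x‖ := by
      rw [map_smul, norm_smul, norm_div, norm_norm, Real.norm_two]
    have e2 : ‖T ((2 / ‖x‖) • x)‖ ≤ c + ‖T‖ := by
      calc ‖T ((2 / ‖x‖) • x)‖ = ‖T y + T ((2 / ‖x‖) • x - y)‖ := by rw [← map_add]; congr 2; abel
        _ ≤ ‖T y‖ + ‖T ((2 / ‖x‖) • x - y)‖ := norm_add_le _ _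
        _ ≤ c + ‖T‖ * 1 := by
          refine add_le_add (h1 y hy) ((T.le_opNorm _).trans ?_)
          gcongr
        _ = c + ‖T‖ := by rw [mul_one]
    rw [e1, div_mul_eq_mul_div, div_le_iff₀ hpos] at e2
    linarith
  linarith

/-- A double sum with vanishing diagonal, as a sum over the pairs above the diagonal. -/
lemma sum_sum_eq_sum_lt {n : ℕ} (F : Fin n → Fin n → ℝ) (hF : ∀ i, F i i = 0) :
    ∑ i, ∑ j, F i j = ∑ e : {e : Fin n × Fin n // e.1 < e.2}, (F e.1.1 e.1.2 + F e.1.2 e.1.1) := by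
  rw [← Finset.sum_subtype (Finset.univ.filter fun e : Fin n × Fin n => e.1 < e.2) (by simp)
    (fun e => F e.1 e.2 + F e.2 e.1), Finset.sum_filter, ← Fintype.sum_prod_type']
  have hswap : ∑ e : Fin n × Fin n, (if e.2 < e.1 then F e.1 e.2 else 0) =
      ∑ e : Fin n × Fin n, if e.1 < e.2 then F e.2 e.1 else 0 :=
    Equiv.sum_comp (Equiv.prodComm (Fin n) (Fin n)) fun e => if e.1 < e.2 then F e.2 e.1 else 0
  calc ∑ e : Fin n × Fin n, F e.1 e.2
      = ∑ e : Fin n × Fin n, ((if e.1 < e.2 then F e.1 e.2 else 0) +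
          if e.2 < e.1 then F e.1 e.2 else 0) := by
        refine Finset.sum_congr rfl fun e _ => ?_
        obtain ⟨i, j⟩ := e
        rcases lt_trichotomy i j with h | h | h
        · simp [h, not_lt_of_gt h]
        · simp [h, hF]
        · simp [h, not_lt_of_gt h]
    _ = _ := by
        rw [Finset.sum_add_distrib, hswap, ← Finset.sum_add_distrib]
        refine Finset.sum_congr rfl fun e _ => ?_
        split_ifs <;> simp

namespace IsGaussianDisorder

variable {Ω : Type*} [MeasurableSpace Ω] {n : ℕ} {P : Measure Ω}
  {A : Ω → Fin n → Fin n → ℝ}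

lemma hasSubgaussianMGF_entry (hA : IsGaussianDisorder P A) {i j : Fin n} (hij : i ≠ j) :
    HasSubgaussianMGF (fun ω => A ω i j) 1 P where
  integrable_exp_mul t := by
    have h := integrable_exp_mul_gaussianReal (μ := 0) (v := 1) t
    rw [← hA.map_entry hij] at h
    exact (integrable_map_measure (by fun_prop) (hA.measurable_entry i j).aemeasurable).mp h
  mgf_le t := by
    rw [mgf_gaussianReal (hA.map_entry hij)]
    simp

/-- A fixed bilinear form of the disorder is sub-Gaussian. -/
lemma measureReal_bilin_ge_le (hA : IsGaussianDisorder P A) (x y : EuclideanSpace ℝ (Fin n))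
    (hx : ‖x‖ ≤ 2) (hy : ‖y‖ ≤ 2) {ε : ℝ} (hε : 0 ≤ ε) :
    P.real {ω | ε ≤ ∑ i, ∑ j, y i * (A ω i j * x j)} ≤ Real.exp (-ε ^ 2 / 64) := by
  let E := {e : Fin n × Fin n // e.1 < e.2}
  let c : E → ℝ := fun e => y e.1.1 * x e.1.2 + y e.1.2 * x e.1.1
  have hsum : ∀ ω, ∑ i, ∑ j, y i * (A ω i j * x j) = ∑ e : E, c e * A ω e.1.1 e.1.2 := by
    intro ω
    rw [sum_sum_eq_sum_lt _ fun i => by simp [hA.diag]]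
    refine Finset.sum_congr rfl fun e _ => ?_
    rw [hA.symm ω e.1.2 e.1.1]
    ring
  have hind : iIndepFun (fun (e : E) ω => c e * A ω e.1.1 e.1.2) P :=
    hA.indep.comp (fun e z => c e * z) fun e => by fun_prop
  have hsub := HasSubgaussianMGF.sum_of_iIndepFun hind (s := Finset.univ)
    fun e _ => (hA.hasSubgaussianMGF_entry e.2.ne).const_mul (c e)
  have hvar : ∑ e : E, c e ^ 2 ≤ 32 := by
    have hx2 : ∑ j, x j ^ 2 ≤ 4 := by
      have := EuclideanSpace.real_norm_sq_eq x
      rw [← this]; nlinarith [norm_nonneg x]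
    have hy2 : ∑ j, y j ^ 2 ≤ 4 := by
      have := EuclideanSpace.real_norm_sq_eq y
      rw [← this]; nlinarith [norm_nonneg y]
    calc ∑ e : E, c e ^ 2
        ≤ ∑ e : E, ((if e.1.1 = e.1.2 then 0 else 2 * (y e.1.1 ^ 2 * x e.1.2 ^ 2)) +
            if e.1.2 = e.1.1 then 0 else 2 * (y e.1.2 ^ 2 * x e.1.1 ^ 2)) := by
          refine Finset.sum_le_sum fun e _ => ?_
          rw [if_neg e.2.ne, if_neg e.2.ne']
          nlinarith [sq_nonneg (y e.1.1 * x e.1.2 - y e.1.2 * x e.1.1)]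
      _ = ∑ i, ∑ j, if i = j then 0 else 2 * (y i ^ 2 * x j ^ 2) :=
          (sum_sum_eq_sum_lt (fun i j => if i = j then 0 else 2 * (y i ^ 2 * x j ^ 2))
            fun i => by simp).symm
      _ ≤ ∑ i, ∑ j, 2 * (y i ^ 2 * x j ^ 2) := by
          refine Finset.sum_le_sum fun i _ => Finset.sum_le_sum fun j _ => ?_
          split_ifs
          · positivity
          · exact le_rfl
      _ = 2 * ((∑ i, y i ^ 2) * ∑ j, x j ^ 2) := by
          rw [Finset.sum_mul_sum, Finset.mul_sum]
          simp only [Finset.mul_sum]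
      _ ≤ 2 * (4 * 4) := by
          have : 0 ≤ ∑ j, x j ^ 2 := Finset.sum_nonneg fun j _ => sq_nonneg _
          gcongr
      _ = 32 := by norm_num
  have hsub' : HasSubgaussianMGF (fun ω => ∑ e : E, c e * A ω e.1.1 e.1.2) 32 P := by
    refine ⟨hsub.integrable_exp_mul, fun t => (hsub.mgf_le t).trans ?_⟩
    have := mul_le_mul_of_nonneg_right hvar (sq_nonneg t)
    rw [Real.exp_le_exp, NNReal.coe_sum]
    change (∑ e : E, c e ^ 2 * 1) * t ^ 2 / 2 ≤ 32 * t ^ 2 / 2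
    simp only [mul_one]
    linarith
  have := hsub'.measure_ge_le hε
  simp only [hsum]
  refine this.trans (le_of_eq ?_)
  norm_num

/-- Outside an event of probability at most `exp (-n)`, the operator norm of the disorder is at most
`24 √n`. -/
lemma exists_event_norm_le (hA : IsGaussianDisorder P A) : ∃ G : Set Ω, MeasurableSet G ∧
    P.real Gᶜ ≤ Real.exp (-n) ∧
    ∀ ω ∈ G, ∀ v : Fin n → ℝ, ∑ i, (∑ j, A ω i j * v j) ^ 2 ≤ 24 ^ 2 * n * ∑ j, v j ^ 2 := by
  obtain ⟨N, hcard, hN2, hnet⟩ := exists_net n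
  have hmeas : ∀ x y : EuclideanSpace ℝ (Fin n),
      Measurable fun ω => ∑ i, ∑ j, y i * (A ω i j * x j) := fun x y =>
    Finset.measurable_fun_sum _ fun i _ => Finset.measurable_fun_sum _ fun j _ =>
      ((hA.measurable_entry i j).mul_const _).const_mul _
  let bad : EuclideanSpace ℝ (Fin n) × EuclideanSpace ℝ (Fin n) → Set Ω := fun p =>
    {ω | 24 * Real.sqrt n ≤ ∑ i, ∑ j, p.2 i * (A ω i j * p.1 j)}
  refine ⟨(⋃ p ∈ N ×ˢ N, bad p)ᶜ, (Finset.measurableSet_biUnion _ fun p _ =>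
    measurableSet_le measurable_const (hmeas p.1 p.2)).compl, ?_, fun ω hω v => ?_⟩
  · rw [compl_compl]
    have hone : ∀ p ∈ N ×ˢ N, P.real (bad p) ≤ Real.exp (-9 * n) := by
      intro p hp
      rw [Finset.mem_product] at hp
      refine (hA.measureReal_bilin_ge_le p.1 p.2 (hN2 _ hp.1) (hN2 _ hp.2)
        (by positivity)).trans (le_of_eq ?_)
      rw [mul_pow, Real.sq_sqrt (Nat.cast_nonneg n)]
      congr 1
      ring
    have h2 : (2 : ℝ) ≤ Real.exp 1 := by linarith [Real.add_one_le_exp (1 : ℝ)]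
    calc P.real (⋃ p ∈ N ×ˢ N, bad p) ≤ ∑ p ∈ N ×ˢ N, P.real (bad p) :=
          measureReal_biUnion_finset_le _ _
      _ ≤ ∑ p ∈ N ×ˢ N, Real.exp (-9 * n) := Finset.sum_le_sum hone
      _ = (N.card : ℝ) * N.card * Real.exp (-9 * n) := by
          rw [Finset.sum_const, Finset.card_product, nsmul_eq_mul]
          push_cast; ring
      _ ≤ 5 ^ n * 5 ^ n * Real.exp (-9 * n) := by
          have : (N.card : ℝ) ≤ 5 ^ n := by exact_mod_cast hcard
          gcongr
      _ = 25 ^ n * Real.exp (-9 * n) := by rw [← mul_pow]; norm_num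
      _ ≤ Real.exp (8 * n) * Real.exp (-9 * n) := by
          gcongr
          rw [mul_comm, Real.exp_nat_mul]
          gcongr
          rw [show (8 : ℝ) = ((8 : ℕ) : ℝ) * 1 by norm_num, Real.exp_nat_mul]
          calc (25 : ℝ) ≤ 2 ^ 8 := by norm_num
            _ ≤ _ := by gcongr
      _ = Real.exp (-n) := by rw [← Real.exp_add]; congr 1; ring
  · let T := Matrix.toEuclideanCLM (n := Fin n) (𝕜 := ℝ) (Matrix.of (A ω))
    have hT : ∀ x i, T x i = ∑ j, A ω i j * x j := fun x i => by
      simp [T, Matrix.mulVec, dotProduct]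
    have hnorm : ‖T‖ ≤ 24 * Real.sqrt n := by
      refine norm_le_of_net hnet T (by positivity) fun x hx y hy => ?_
      simp only [Set.mem_compl_iff, Set.mem_iUnion, not_exists] at hω
      have := hω (x, y) (Finset.mem_product.mpr ⟨hx, hy⟩)
      simp only [bad, Set.mem_ofPred_eq, not_le] at this
      refine le_of_eq_of_le ?_ this.le
      simp only [PiLp.inner_apply, hT, Finset.sum_mul, RCLike.inner_apply,
        conj_trivial]
      refine Finset.sum_congr rfl fun i _ => Finset.sum_congr rfl fun j _ => ?_
      ring
    have hv := (T.le_opNorm (WithLp.toLp 2 v)).trans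
      (mul_le_mul_of_nonneg_right hnorm (norm_nonneg _))
    have hv2 := pow_le_pow_left₀ (norm_nonneg _) hv 2
    rw [mul_pow, mul_pow, Real.sq_sqrt (Nat.cast_nonneg n), EuclideanSpace.real_norm_sq_eq,
      EuclideanSpace.real_norm_sq_eq] at hv2
    simpa only [hT] using hv2

end IsGaussianDisorder

/-! ### Stability of the AMP recursion -/

section amp

variable {n : ℕ} {f : ℕ → ℝ → ℝ}

lemma amp_one (B : Fin n → Fin n → ℝ) (u : Fin n → ℝ) (i : Fin n) :
    amp f B u 1 i = 1 / Real.sqrt n * ∑ j, B i j * f 0 (u j) := by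
  rw [amp]

lemma amp_add_two (B : Fin n → Fin n → ℝ) (u : Fin n → ℝ) (k : ℕ) (i : Fin n) :
    amp f B u (k + 2) i = 1 / Real.sqrt n * ∑ j, B i j * f (k + 1) (amp f B u (k + 1) j)
      - (1 / n * ∑ j, deriv (f (k + 1)) (amp f B u (k + 1) j)) * f k (amp f B u k i) := by
  rw [amp]

lemma measurable_amp_uncurry {M : ℕ → ℝ} (hf : ∀ k, RegularWith (f k) (M k)) (k : ℕ)
    (i : Fin n) :
    Measurable fun p : (Fin n → Fin n → ℝ) × (Fin n → ℝ) => amp f p.1 p.2 k i := by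
  have hent : ∀ i j : Fin n, Measurable fun p : (Fin n → Fin n → ℝ) × (Fin n → ℝ) => p.1 i j :=
    fun i j => by fun_prop
  suffices h : (∀ i, Measurable fun p : (Fin n → Fin n → ℝ) × (Fin n → ℝ) => amp f p.1 p.2 k i) ∧
      ∀ i, Measurable fun p : (Fin n → Fin n → ℝ) × (Fin n → ℝ) => amp f p.1 p.2 (k + 1) i from
    h.1 i
  induction k with
  | zero =>
    refine ⟨fun i => ?_, fun i => ?_⟩
    · simp only [amp]
      fun_prop
    · simp only [zero_add, amp_one]
      exact (Finset.measurable_fun_sum _ fun j _ => (hent i j).mul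
        ((hf 0).measurable.comp (by fun_prop))).const_mul _
  | succ k ih =>
    refine ⟨ih.2, fun i => ?_⟩
    simp only [amp_add_two]
    refine ((Finset.measurable_fun_sum _ fun j _ => (hent i j).mul
      ((hf _).measurable.comp (ih.2 j))).const_mul _).sub (Measurable.mul ?_
        ((hf _).measurable.comp (ih.1 i)))
    exact (Finset.measurable_fun_sum _ fun j _ =>
      (hf _).measurable_deriv.comp (ih.2 j)).const_mul _

/-- The normalized squared distance `‖u^{[k]} - w^{[k]}‖²`. -/
noncomputable def ampError (f : ℕ → ℝ → ℝ) (u : Fin n → ℝ) (k : ℕ) (B : Fin n → Fin n → ℝ) : ℝ :=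
  (∑ i, (amp f B u k i - cavity f B u k ∅ i) ^ 2) / n

lemma ampError_nonneg (u : Fin n → ℝ) (k : ℕ) (B : Fin n → Fin n → ℝ) :
    0 ≤ ampError f u k B :=
  div_nonneg (Finset.sum_nonneg fun _ _ => sq_nonneg _) (Nat.cast_nonneg n)

lemma ampError_zero (u : Fin n → ℝ) (B : Fin n → Fin n → ℝ) : ampError f u 0 B = 0 := by
  simp [ampError, amp, cavity]

lemma ampError_one (u : Fin n → ℝ) {B : Fin n → Fin n → ℝ} (hB : ∀ i, B i i = 0) :
    ampError f u 1 B = 0 := by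
  have h : ∀ i, amp f B u 1 i - cavity f B u 1 ∅ i = 0 := fun i => by
    rw [amp_one, cavity_succ, Finset.empty_union,
      ← Finset.sum_sdiff (Finset.subset_univ ({i} : Finset (Fin n))), Finset.sum_singleton, hB]
    simp [cavity]
  simp [ampError, h]

/-- The square of an average is at most the average of the squares. -/
lemma sq_average_le (x : Fin n → ℝ) : (1 / (n : ℝ) * ∑ j, x j) ^ 2 ≤ (∑ j, x j ^ 2) / n := by
  rcases Nat.eq_zero_or_pos n with rfl | hn
  · simp
  have hn' : (0 : ℝ) < n := by exact_mod_cast hn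
  have h := sq_sum_le_card_mul_sum_sq (s := Finset.univ) (f := x)
  rw [Finset.card_univ, Fintype.card_fin] at h
  rw [mul_pow, div_pow, one_pow, one_div, inv_mul_le_iff₀ (by positivity)]
  calc (∑ j, x j) ^ 2 ≤ n * ∑ j, x j ^ 2 := h
    _ = (n : ℝ) ^ 2 * ((∑ j, x j ^ 2) / n) := by field_simp

/-- One step of the AMP recursion is stable where the operator norm is `O(√n)`: the new error is
controlled by the two previous ones and by the defect of the cavity iteration. -/
lemma ampError_add_two_le {M : ℕ → ℝ} (hf : ∀ k, RegularWith (f k) (M k)) (u : Fin n → ℝ) (m : ℕ)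
    {B : Fin n → Fin n → ℝ}
    (hB : ∀ v : Fin n → ℝ, ∑ i, (∑ j, B i j * v j) ^ 2 ≤ 24 ^ 2 * n * ∑ j, v j ^ 2) :
    ampError f u (m + 2) B ≤
      (3 * 24 ^ 2 * M (m + 1) ^ 2 + 6 * (M (m + 1) * M m) ^ 2) * ampError f u (m + 1) B +
      6 * (M (m + 1) * M m) ^ 2 * ampError f u m B +
      3 * ((∑ i, ampDefect f u m i B ^ 2) / n) := by
  rcases Nat.eq_zero_or_pos n with rfl | hn
  · simp [ampError]
  have hn' : (0 : ℝ) < n := by exact_mod_cast hn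
  set K := M (m + 1)
  set L := M m
  have hK : 0 ≤ K := (hf (m + 1)).nonneg
  have hL : 0 ≤ L := (hf m).nonneg
  set x : Fin n → ℝ := amp f B u (m + 1) with hx
  set w : Fin n → ℝ := fun j => cavity f B u (m + 1) ∅ j with hw
  set y : Fin n → ℝ := amp f B u m with hy
  set z : Fin n → ℝ := fun j => cavity f B u m ∅ j with hz
  set bx := 1 / (n : ℝ) * ∑ j, deriv (f (m + 1)) (x j) with hbx
  set bw := 1 / (n : ℝ) * ∑ j, deriv (f (m + 1)) (w j) with hbw
  set X : Fin n → ℝ := fun i => 1 / Real.sqrt n *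
    ∑ j, B i j * (f (m + 1) (x j) - f (m + 1) (w j)) with hX
  have hdecomp : ∀ i, amp f B u (m + 2) i - cavity f B u (m + 2) ∅ i =
      X i + ampDefect f u m i B - (bx * (f m (y i) - f m (z i)) + (bx - bw) * f m (z i)) := by
    intro i
    rw [amp_add_two]
    simp only [ampDefect, hX, mul_sub, Finset.sum_sub_distrib, ← hx, ← hy, ← hbx]
    change _ = _ + (_ - bw * f m (z i) - _) - _
    ring
  have hE1 : ampError f u (m + 1) B = (∑ j, (x j - w j) ^ 2) / n := rfl
  have hE0 : ampError f u m B = (∑ j, (y j - z j) ^ 2) / n := rfl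
  have hXsum : (∑ i, X i ^ 2) / n ≤ 24 ^ 2 * K ^ 2 * ampError f u (m + 1) B := by
    have h1 : ∑ i, X i ^ 2 ≤ 24 ^ 2 * ∑ j, (f (m + 1) (x j) - f (m + 1) (w j)) ^ 2 := by
      simp only [hX, mul_pow, div_pow, one_pow, Real.sq_sqrt hn'.le]
      rw [← Finset.mul_sum, one_div, inv_mul_le_iff₀ hn']
      calc _ ≤ _ := hB _
        _ = _ := by ring
    have h2 : ∑ j, (f (m + 1) (x j) - f (m + 1) (w j)) ^ 2 ≤ K ^ 2 * ∑ j, (x j - w j) ^ 2 := by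
      rw [Finset.mul_sum]
      refine Finset.sum_le_sum fun j _ => ?_
      rw [← sq_abs, ← sq_abs (x j - w j), ← mul_pow]
      gcongr
      exact (hf (m + 1)).lipschitz _ _
    rw [hE1, ← mul_div_assoc]
    gcongr
    calc _ ≤ _ := h1
      _ ≤ 24 ^ 2 * (K ^ 2 * ∑ j, (x j - w j) ^ 2) := by gcongr
      _ = _ := by ring
  have hbx2 : bx ^ 2 ≤ K ^ 2 := by
    refine (sq_average_le _).trans ?_
    rw [div_le_iff₀ hn']
    calc ∑ j, deriv (f (m + 1)) (x j) ^ 2 ≤ ∑ _j : Fin n, K ^ 2 := by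
          refine Finset.sum_le_sum fun j _ => ?_
          rw [← sq_abs]
          gcongr
          exact (hf (m + 1)).deriv_bound _
      _ = K ^ 2 * n := by simp [mul_comm]
  have hbd : (bx - bw) ^ 2 ≤ K ^ 2 * ampError f u (m + 1) B := by
    rw [hbx, hbw, ← mul_sub, ← Finset.sum_sub_distrib]
    refine (sq_average_le _).trans ?_
    rw [hE1, ← mul_div_assoc, Finset.mul_sum]
    gcongr with j
    rw [← sq_abs, ← sq_abs (x j - w j), ← mul_pow]
    gcongr
    exact (hf (m + 1)).deriv_lipschitz _ _
  have hpt : ∀ i, (amp f B u (m + 2) i - cavity f B u (m + 2) ∅ i) ^ 2 ≤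
      3 * X i ^ 2 + 3 * ampDefect f u m i B ^ 2 + 6 * (K * L) ^ 2 * (y i - z i) ^ 2 +
        6 * L ^ 2 * (K ^ 2 * ampError f u (m + 1) B) := by
    intro i
    rw [hdecomp i]
    have h1 : (bx * (f m (y i) - f m (z i))) ^ 2 ≤ K ^ 2 * (L ^ 2 * (y i - z i) ^ 2) := by
      rw [mul_pow]
      have : (f m (y i) - f m (z i)) ^ 2 ≤ L ^ 2 * (y i - z i) ^ 2 := by
        rw [← sq_abs, ← sq_abs (y i - z i), ← mul_pow]
        gcongr
        exact (hf m).lipschitz _ _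
      gcongr
    have h2 : ((bx - bw) * f m (z i)) ^ 2 ≤ K ^ 2 * ampError f u (m + 1) B * L ^ 2 := by
      rw [mul_pow]
      have h3 : f m (z i) ^ 2 ≤ L ^ 2 := by
        rw [← sq_abs]
        gcongr
        exact (hf m).bound _
      have := ampError_nonneg (f := f) u (m + 1) B
      gcongr
    generalize bx * (f m (y i) - f m (z i)) = p at h1 ⊢
    generalize (bx - bw) * f m (z i) = q at h2 ⊢
    generalize ampDefect f u m i B = t
    nlinarith [sq_nonneg (X i - t), sq_nonneg (X i + (p + q)), sq_nonneg (t + (p + q)),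
      sq_nonneg (p - q)]
  calc ampError f u (m + 2) B
      ≤ (∑ i, (3 * X i ^ 2 + 3 * ampDefect f u m i B ^ 2 + 6 * (K * L) ^ 2 * (y i - z i) ^ 2 +
        6 * L ^ 2 * (K ^ 2 * ampError f u (m + 1) B))) / n := by
        rw [ampError]
        gcongr with i
        exact hpt i
    _ = 3 * ((∑ i, X i ^ 2) / n) + 3 * ((∑ i, ampDefect f u m i B ^ 2) / n) +
        6 * (K * L) ^ 2 * ampError f u m B + 6 * L ^ 2 * (K ^ 2 * ampError f u (m + 1) B) := by
        rw [hE0]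
        simp only [Finset.sum_add_distrib, ← Finset.mul_sum, Finset.sum_const, Finset.card_univ,
          Fintype.card_fin, nsmul_eq_mul]
        field_simp
    _ ≤ _ := by nlinarith [hXsum]

/-- Iterating the stability estimate: the error is controlled by the defects alone. -/
lemma exists_ampError_le (M : ℕ → ℝ) (k : ℕ) : ∃ C : ℝ, 0 ≤ C ∧
    ∀ {n : ℕ} {f : ℕ → ℝ → ℝ}, (∀ k, RegularWith (f k) (M k)) →
    ∀ (u : Fin n → ℝ) {B : Fin n → Fin n → ℝ}, (∀ i, B i i = 0) →
    (∀ v : Fin n → ℝ, ∑ i, (∑ j, B i j * v j) ^ 2 ≤ 24 ^ 2 * n * ∑ j, v j ^ 2) →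
    ampError f u k B ≤ C * ∑ m ∈ Finset.range k, (∑ i, ampDefect f u m i B ^ 2) / n := by
  induction k using Nat.strong_induction_on with
  | _ k ih =>
  match k, ih with
  | 0, _ => exact ⟨0, le_rfl, fun _ u B _ _ => by simp [ampError_zero]⟩
  | 1, _ => exact ⟨0, le_rfl, fun _ u B hB _ => by simp [ampError_one u hB]⟩
  | m + 2, ih =>
    obtain ⟨C0, hC0, h0⟩ := ih m (by omega)
    obtain ⟨C1, hC1, h1⟩ := ih (m + 1) (by omega)
    refine ⟨(3 * 24 ^ 2 * M (m + 1) ^ 2 + 6 * (M (m + 1) * M m) ^ 2) * C1 +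
      6 * (M (m + 1) * M m) ^ 2 * C0 + 3, by positivity, fun {n f} hf u B hB hop => ?_⟩
    have hstep := ampError_add_two_le hf u m hop
    have hT : ∀ p, 0 ≤ (∑ i, ampDefect f u p i B ^ 2) / n := fun p =>
      div_nonneg (Finset.sum_nonneg fun _ _ => sq_nonneg _) (Nat.cast_nonneg n)
    set T : ℕ → ℝ := fun p => (∑ i, ampDefect f u p i B ^ 2) / n with hTdef
    have hmono : ∀ a, a ≤ m + 2 → ∑ p ∈ Finset.range a, T p ≤ ∑ p ∈ Finset.range (m + 2), T p :=
      fun a ha => Finset.sum_le_sum_of_subset_of_nonneg (Finset.range_mono ha) fun p _ _ => hT p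
    have hsingle : T m ≤ ∑ p ∈ Finset.range (m + 2), T p :=
      Finset.single_le_sum (fun p _ => hT p) (Finset.mem_range.mpr (by omega))
    have e1 : ampError f u (m + 1) B ≤ C1 * ∑ p ∈ Finset.range (m + 2), T p :=
      (h1 hf u hB hop).trans (mul_le_mul_of_nonneg_left (hmono _ (by omega)) hC1)
    have e0 : ampError f u m B ≤ C0 * ∑ p ∈ Finset.range (m + 2), T p :=
      (h0 hf u hB hop).trans (mul_le_mul_of_nonneg_left (hmono _ (by omega)) hC0)
    calc _ ≤ _ := hstep
      _ ≤ (3 * 24 ^ 2 * M (m + 1) ^ 2 + 6 * (M (m + 1) * M m) ^ 2) *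
            (C1 * ∑ p ∈ Finset.range (m + 2), T p) +
          6 * (M (m + 1) * M m) ^ 2 * (C0 * ∑ p ∈ Finset.range (m + 2), T p) +
          3 * ∑ p ∈ Finset.range (m + 2), T p := by gcongr
      _ = _ := by ring

/-- A crude bound, for use on an event of exponentially small probability. -/
lemma exists_ampError_le_crude (M : ℕ → ℝ) (k : ℕ) : ∃ C : ℝ, 0 ≤ C ∧
    ∀ {n : ℕ} {f : ℕ → ℝ → ℝ}, (∀ k, RegularWith (f k) (M k)) →
    ∀ (u : Fin n → ℝ) {B : Fin n → Fin n → ℝ}, (∀ i, B i i = 0) →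
    ampError f u k B ≤ C * (1 + 1 / (n : ℝ) * ∑ j, ∑ i, B i j ^ 2) := by
  match k with
  | 0 => exact ⟨0, le_rfl, fun _ u B _ => by simp [ampError_zero]⟩
  | 1 => exact ⟨0, le_rfl, fun _ u B hB => by simp [ampError_one u hB]⟩
  | m + 2 =>
    set K := M (m + 1)
    set L := M m
    refine ⟨8 * K ^ 2 + 2 * (K * L) ^ 2, by positivity, fun {n f} hf u B hB => ?_⟩
    rcases Nat.eq_zero_or_pos n with rfl | hn
    · simp only [ampError, Finset.univ_eq_empty, Finset.sum_empty, zero_div]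
      positivity
    have hn' : (0 : ℝ) < n := by exact_mod_cast hn
    have hK : 0 ≤ K := (hf (m + 1)).nonneg
    have hL : 0 ≤ L := (hf m).nonneg
    -- A normalized row sum with coefficients bounded by `2 K`.
    have hrow : ∀ (i : Fin n) (v : Fin n → ℝ), (∀ j, |v j| ≤ 2 * K) →
        (1 / Real.sqrt n * ∑ j, B i j * v j) ^ 2 ≤ 4 * K ^ 2 * ∑ j, B i j ^ 2 := by
      intro i v hv
      rw [mul_pow, div_pow, one_pow, Real.sq_sqrt hn'.le, one_div, inv_mul_le_iff₀ hn']
      have h := Finset.sum_mul_sq_le_sq_mul_sq Finset.univ (B i) v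
      have hv2 : ∑ j, v j ^ 2 ≤ n * (2 * K) ^ 2 := by
        calc ∑ j, v j ^ 2 ≤ ∑ _j : Fin n, (2 * K) ^ 2 := by
              refine Finset.sum_le_sum fun j _ => ?_
              rw [← sq_abs]
              gcongr
              exact hv j
          _ = _ := by simp
      calc _ ≤ _ := h
        _ ≤ (∑ j, B i j ^ 2) * (n * (2 * K) ^ 2) := by gcongr
        _ = _ := by ring
    have hpt : ∀ i, (amp f B u (m + 2) i - cavity f B u (m + 2) ∅ i) ^ 2 ≤
        8 * K ^ 2 * ∑ j, B i j ^ 2 + 2 * (K * L) ^ 2 := by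
      intro i
      have e : amp f B u (m + 2) i - cavity f B u (m + 2) ∅ i =
          1 / Real.sqrt n * ∑ j, B i j * (f (m + 1) (amp f B u (m + 1) j) -
            f (m + 1) (cavity f B u (m + 1) {i} j)) -
          (1 / n * ∑ j, deriv (f (m + 1)) (amp f B u (m + 1) j)) * f m (amp f B u m i) := by
        have hc : cavity f B u (m + 2) ∅ i =
            1 / Real.sqrt n * ∑ j, B i j * f (m + 1) (cavity f B u (m + 1) {i} j) := by
          rw [cavity_succ B u (m + 1) ∅ i, Finset.empty_union,
            ← Finset.sum_sdiff (Finset.subset_univ ({i} : Finset (Fin n))),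
            Finset.sum_singleton, hB, zero_mul, add_zero]
        rw [amp_add_two, hc]
        simp only [mul_sub, Finset.sum_sub_distrib]
        ring
      have h1 := hrow i (fun j => f (m + 1) (amp f B u (m + 1) j) -
        f (m + 1) (cavity f B u (m + 1) {i} j)) fun j => by
          refine (abs_sub _ _).trans ?_
          linarith [(hf (m + 1)).bound (amp f B u (m + 1) j),
            (hf (m + 1)).bound (cavity f B u (m + 1) {i} j)]
      have h2 : ((1 / (n : ℝ) * ∑ j, deriv (f (m + 1)) (amp f B u (m + 1) j)) *
          f m (amp f B u m i)) ^ 2 ≤ (K * L) ^ 2 := by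
        rw [mul_pow _ (f m (amp f B u m i)), mul_pow K L]
        have h3 : (1 / (n : ℝ) * ∑ j, deriv (f (m + 1)) (amp f B u (m + 1) j)) ^ 2 ≤ K ^ 2 := by
          refine (sq_average_le _).trans ?_
          rw [div_le_iff₀ hn']
          calc ∑ j, deriv (f (m + 1)) (amp f B u (m + 1) j) ^ 2 ≤ ∑ _j : Fin n, K ^ 2 := by
                refine Finset.sum_le_sum fun j _ => ?_
                rw [← sq_abs]
                gcongr
                exact (hf (m + 1)).deriv_bound _
            _ = K ^ 2 * n := by simp [mul_comm]
        have h4 : f m (amp f B u m i) ^ 2 ≤ L ^ 2 := by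
          rw [← sq_abs]
          gcongr
          exact (hf m).bound _
        exact mul_le_mul h3 h4 (sq_nonneg _) (sq_nonneg _)
      rw [e]
      generalize 1 / Real.sqrt n * ∑ j, B i j * (f (m + 1) (amp f B u (m + 1) j) -
            f (m + 1) (cavity f B u (m + 1) {i} j)) = p at h1 ⊢
      generalize (1 / (n : ℝ) * ∑ j, deriv (f (m + 1)) (amp f B u (m + 1) j)) *
          f m (amp f B u m i) = q at h2 ⊢
      nlinarith [sq_nonneg (p + q)]
    have hS : 0 ≤ ∑ i, ∑ j, B i j ^ 2 :=
      Finset.sum_nonneg fun i _ => Finset.sum_nonneg fun j _ => sq_nonneg _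
    calc ampError f u (m + 2) B
        ≤ (∑ i, (8 * K ^ 2 * ∑ j, B i j ^ 2 + 2 * (K * L) ^ 2)) / n := by
          rw [ampError]
          gcongr with i
          exact hpt i
      _ = 8 * K ^ 2 * (1 / (n : ℝ) * ∑ i, ∑ j, B i j ^ 2) + 2 * (K * L) ^ 2 := by
          simp only [Finset.sum_add_distrib, ← Finset.mul_sum, Finset.sum_const, Finset.card_univ,
            Fintype.card_fin, nsmul_eq_mul]
          field_simp
      _ ≤ _ := by
          rw [Finset.sum_comm (f := fun j i => B i j ^ 2)]
          have h1 : 0 ≤ 1 / (n : ℝ) * ∑ i, ∑ j, B i j ^ 2 := mul_nonneg (by positivity) hS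
          nlinarith [mul_nonneg (sq_nonneg (K * L)) h1, sq_nonneg K]

end amp

/-! ### Expectations -/

lemma rmsNorm_sq {n : ℕ} (x : Fin n → ℝ) : rmsNorm x ^ 2 = (∑ i, x i ^ 2) / n :=
  Real.sq_sqrt (div_nonneg (Finset.sum_nonneg fun _ _ => sq_nonneg _) (Nat.cast_nonneg n))

lemma measurable_ampError_uncurry {n : ℕ} {f : ℕ → ℝ → ℝ} {M : ℕ → ℝ}
    (hf : ∀ k, RegularWith (f k) (M k)) (k : ℕ) :
    Measurable fun p : (Fin n → Fin n → ℝ) × (Fin n → ℝ) => ampError f p.2 k p.1 :=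
  (Finset.measurable_fun_sum _ fun i _ => ((measurable_amp_uncurry hf k i).sub
    (measurable_cavity_uncurry (fun k => (hf k).measurable) k ∅ i)).pow_const 2).div_const _

/-- `n³ exp (-n) ≤ 24 / n`: the event of large operator norm is negligible. -/
lemma pow_three_mul_exp_neg_le {n : ℕ} (hn : 0 < n) :
    (n : ℝ) ^ 3 * Real.exp (-n) ≤ 24 / n := by
  have hn' : (0 : ℝ) < n := by exact_mod_cast hn
  have h := Real.pow_div_factorial_le_exp (n : ℝ) hn'.le 4
  rw [Real.exp_neg, ← div_eq_mul_inv, div_le_div_iff₀ (Real.exp_pos _) hn']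
  have : (Nat.factorial 4 : ℝ) = 24 := by norm_num [Nat.factorial]
  rw [this, div_le_iff₀ (by norm_num)] at h
  linarith [show (n : ℝ) ^ 3 * n = (n : ℝ) ^ 4 by ring]

namespace IsGaussianDisorder

/-- The estimate for a deterministic initial vector, with a constant that does not depend on it. -/
theorem exists_integral_ampError_le (M : ℕ → ℝ) (k : ℕ) : ∃ C : ℝ, 0 < C ∧
    ∀ {Ω : Type v} [MeasurableSpace Ω] {n : ℕ} {P : Measure Ω} [IsProbabilityMeasure P]
      {A : Ω → Fin n → Fin n → ℝ} {f : ℕ → ℝ → ℝ}, 0 < n → IsGaussianDisorder P A →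
      (∀ k, RegularWith (f k) (M k)) → ∀ u : Fin n → ℝ,
      Integrable (fun ω => ampError f u k (A ω)) P ∧
        ∫ ω, ampError f u k (A ω) ∂P ≤ C / n := by
  obtain ⟨C₁, hC₁, h₁⟩ := exists_ampError_le M k
  obtain ⟨C₂, hC₂, h₂⟩ := exists_ampError_le_crude M k
  choose D hD0 hD using exists_meanSqLe_ampDefect.{v} M
  obtain ⟨q, hq⟩ : ∃ q, q = ∫ x, (x ^ 2) ^ 2 ∂gaussianReal 0 1 := ⟨_, rfl⟩
  have hq0 : 0 ≤ q := hq ▸ integral_nonneg fun x => sq_nonneg _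
  refine ⟨C₁ * ∑ m ∈ Finset.range k, D m + (24 + C₂ ^ 2 * (2 + 2 * q)) + 1, ?_, ?_⟩
  · have := Finset.sum_nonneg fun m (_ : m ∈ Finset.range k) => hD0 m
    positivity
  intro Ω _ n P _ A f hn hA hf u
  have hn' : (0 : ℝ) < n := by exact_mod_cast hn
  have hn1 : (1 : ℝ) ≤ n := by exact_mod_cast hn
  obtain ⟨G, hGm, hGP, hG⟩ := hA.exists_event_norm_le
  have hmeas : Measurable fun ω => ampError f u k (A ω) :=
    Measurable.comp (g := fun p : (Fin n → Fin n → ℝ) × (Fin n → ℝ) => ampError f p.2 k p.1)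
      (f := fun ω => (A ω, u)) (measurable_ampError_uncurry hf k)
      (hA.measurable.prodMk measurable_const)
  -- The crude bound has second moment `O(n²)`.
  set W : Ω → ℝ := fun ω => C₂ * (1 + 1 / (n : ℝ) * ∑ j, ∑ i, A ω i j ^ 2) with hW
  have hWsq : MeanSqLe P W (C₂ ^ 2 * (2 + 2 * q) * n ^ 2) := by
    have hentry : ∀ i j, MeanSqLe P (fun ω => A ω i j ^ 2) q := by
      intro i j
      by_cases hij : i = j
      · subst hij
        simpa [hA.diag] using MeanSqLe.zero.weaken hq0
      · have h4 : Integrable (fun x : ℝ => (x ^ 2) ^ 2) (gaussianReal 0 1) := by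
          simpa only [← pow_mul] using integrable_pow_gaussianReal 4
        have := hA.meanSqLe_entry_mul hij (φ := fun x => x ^ 2) (by fun_prop) h4 (F := fun _ => 1)
          measurable_const (fun _ => rfl) (MeanSqLe.of_abs_le (b := 1) measurable_const (by simp))
        simpa [← hq] using this
    have hcol : ∀ j, MeanSqLe P (fun ω => ∑ i, A ω i j ^ 2) (n * (n * q)) := fun j => by
      simpa using MeanSqLe.sum Finset.univ fun i _ => hentry i j
    have h1 : MeanSqLe P (fun _ : Ω => (1 : ℝ)) (1 ^ 2) :=
      MeanSqLe.of_abs_le measurable_const (by simp)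
    have h2 := (h1.add (MeanSqLe.average Finset.univ (by positivity) fun j _ => hcol j)).const_mul
      C₂
    refine h2.weaken ?_
    rw [mul_assoc]
    gcongr
    nlinarith
  -- On the good event the defects control the error; off it, Young's inequality is applied to
  -- the crude bound, with weight `n³`.
  set R : Ω → ℝ := fun ω => C₁ * (∑ m ∈ Finset.range k, (∑ i, ampDefect f u m i (A ω) ^ 2) / n) +
    (1 / 2 * (Gᶜ.indicator (fun _ => (n : ℝ) ^ 3) ω) + 1 / (2 * n ^ 3) * W ω ^ 2) with hR
  have hle : ∀ ω, ampError f u k (A ω) ≤ R ω := by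
    intro ω
    have hT : 0 ≤ C₁ * ∑ m ∈ Finset.range k, (∑ i, ampDefect f u m i (A ω) ^ 2) / (n : ℝ) :=
      mul_nonneg hC₁ (Finset.sum_nonneg fun m _ =>
        div_nonneg (Finset.sum_nonneg fun _ _ => sq_nonneg _) hn'.le)
    by_cases hω : ω ∈ G
    · have h1 := h₁ hf u (hA.diag ω) (hG ω hω)
      have h2 : 0 ≤ 1 / (2 * (n : ℝ) ^ 3) * W ω ^ 2 := by positivity
      simp only [hR, Set.indicator_of_notMem (Set.notMem_compl_iff.mpr hω)]
      linarith
    · have h1 : ampError f u k (A ω) ≤ W ω := h₂ hf u (hA.diag ω)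
      have h2 : W ω ≤ 1 / 2 * (n : ℝ) ^ 3 + 1 / (2 * n ^ 3) * W ω ^ 2 := by
        have h3 : 0 ≤ 1 / (2 * (n : ℝ) ^ 3) * ((n : ℝ) ^ 3 - W ω) ^ 2 := by positivity
        have h4 : 1 / (2 * (n : ℝ) ^ 3) * ((n : ℝ) ^ 3 - W ω) ^ 2 =
            1 / 2 * (n : ℝ) ^ 3 + 1 / (2 * n ^ 3) * W ω ^ 2 - W ω := by
          field_simp
          ring
        linarith
      simp only [hR, Set.indicator_of_mem (Set.mem_compl hω)]
      linarith
  have hdef := fun m i => hD m hA hf u i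
  have i1 : Integrable (fun ω => ∑ m ∈ Finset.range k,
      (∑ i, ampDefect f u m i (A ω) ^ 2) / (n : ℝ)) P :=
    integrable_finsetSum _ fun m _ =>
      (integrable_finsetSum _ fun i _ => (hdef m i).integrable_sq).div_const _
  have i2 : Integrable (Gᶜ.indicator (fun _ : Ω => (n : ℝ) ^ 3)) P :=
    (integrable_const _).indicator hGm.compl
  have i3 := hWsq.integrable_sq
  have i23 : Integrable (fun ω => 1 / 2 * (Gᶜ.indicator (fun _ => (n : ℝ) ^ 3) ω) +
      1 / (2 * (n : ℝ) ^ 3) * W ω ^ 2) P := (i2.const_mul _).add (i3.const_mul _)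
  have iR : Integrable R P := (i1.const_mul C₁).add i23
  have hint : Integrable (fun ω => ampError f u k (A ω)) P :=
    iR.mono' hmeas.aestronglyMeasurable (Filter.Eventually.of_forall fun ω => by
      rw [Real.norm_eq_abs, abs_of_nonneg (ampError_nonneg u k (A ω))]
      exact hle ω)
  refine ⟨hint, (integral_mono hint iR hle).trans ?_⟩
  have b1 : ∫ ω, ∑ m ∈ Finset.range k, (∑ i, ampDefect f u m i (A ω) ^ 2) / (n : ℝ) ∂P ≤
      ∑ m ∈ Finset.range k, D m / n := by
    rw [integral_finsetSum _ fun m _ =>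
      (integrable_finsetSum _ fun i _ => (hdef m i).integrable_sq).div_const _]
    refine Finset.sum_le_sum fun m _ => ?_
    rw [integral_div, integral_finsetSum _ fun i _ => (hdef m i).integrable_sq,
      div_le_iff₀ hn']
    calc _ ≤ ∑ _i : Fin n, D m / n := Finset.sum_le_sum fun i _ => (hdef m i).2
      _ = D m / n * n := by simp [mul_comm]
  have b2 : ∫ ω, Gᶜ.indicator (fun _ : Ω => (n : ℝ) ^ 3) ω ∂P ≤ 24 / n := by
    rw [integral_indicator_const _ hGm.compl, smul_eq_mul, mul_comm]
    exact (mul_le_mul_of_nonneg_left hGP (by positivity)).trans (pow_three_mul_exp_neg_le hn)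
  have b3 : 1 / (2 * (n : ℝ) ^ 3) * ∫ ω, W ω ^ 2 ∂P ≤ C₂ ^ 2 * (2 + 2 * q) / n := by
    calc _ ≤ 1 / (2 * (n : ℝ) ^ 3) * (C₂ ^ 2 * (2 + 2 * q) * n ^ 2) :=
          mul_le_mul_of_nonneg_left hWsq.2 (by positivity)
      _ = 1 / 2 * (C₂ ^ 2 * (2 + 2 * q) / n) := by field_simp
      _ ≤ _ := by
          have : 0 ≤ C₂ ^ 2 * (2 + 2 * q) / n := by positivity
          linarith
  have e : ∫ ω, R ω ∂P = C₁ * ∫ ω, ∑ m ∈ Finset.range k,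
      (∑ i, ampDefect f u m i (A ω) ^ 2) / (n : ℝ) ∂P +
      (1 / 2 * ∫ ω, Gᶜ.indicator (fun _ : Ω => (n : ℝ) ^ 3) ω ∂P +
        1 / (2 * (n : ℝ) ^ 3) * ∫ ω, W ω ^ 2 ∂P) := by
    rw [hR, integral_add (i1.const_mul C₁) i23,
      integral_add (i2.const_mul _) (i3.const_mul _), integral_const_mul, integral_const_mul,
      integral_const_mul]
  have h24 : (0 : ℝ) ≤ 24 / n := by positivity
  have h1n : (0 : ℝ) ≤ 1 / n := by positivity
  calc ∫ ω, R ω ∂P ≤ C₁ * ∑ m ∈ Finset.range k, D m / n +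
        (24 / n + C₂ ^ 2 * (2 + 2 * q) / n) + 1 / n := by
        rw [e]
        have := mul_le_mul_of_nonneg_left b1 hC₁
        linarith
    _ = _ := by
        rw [← Finset.sum_div]
        ring

end IsGaussianDisorder

end CavityAMP

open MeasureTheory ProbabilityTheory CavityAMP in
theorem theorem2
    {Ω : ℕ → Type*} [∀ n, MeasurableSpace (Ω n)]
    (P : ∀ n, Measure (Ω n)) [∀ n, IsProbabilityMeasure (P n)]
    (A : ∀ n, Ω n → Fin n → Fin n → ℝ) (hA : ∀ n, IsGaussianDisorder (P n) (A n))
    (u : ∀ n, Ω n → Fin n → ℝ) (hu_meas : ∀ n, Measurable (u n))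
    (hu_indep : ∀ n, IndepFun (u n) (A n) (P n))
    (hu_norm : ∀ n, ∀ᵐ ω ∂(P n), rmsNorm (u n ω) ≤ 1)
    (f : ℕ → ℝ → ℝ) (hf : ∀ k, SmoothBounded (f k)) :
    ∀ k : ℕ, ∃ C : ℝ, 0 < C ∧ ∀ n : ℕ, k + 1 ≤ n →
      Integrable (fun ω => rmsNorm (fun i =>
        amp f (A n ω) (u n ω) k i - cavity f (A n ω) (u n ω) k ∅ i) ^ 2) (P n) ∧
      ∫ ω, rmsNorm (fun i =>
        amp f (A n ω) (u n ω) k i - cavity f (A n ω) (u n ω) k ∅ i) ^ 2 ∂(P n) ≤ C / n := by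
  intro k
  choose M hM using fun k => (hf k).exists_regularWith
  obtain ⟨C, hC, h⟩ := IsGaussianDisorder.exists_integral_ampError_le M k
  refine ⟨C, hC, fun n hkn => ?_⟩
  have hn : 0 < n := by omega
  simp only [rmsNorm_sq]
  change Integrable (fun ω => ampError f (u n ω) k (A n ω)) (P n) ∧
    ∫ ω, ampError f (u n ω) k (A n ω) ∂P n ≤ C / n
  -- By independence, the expectation may be computed for each fixed value of `u` first.
  have hmeas := measurable_ampError_uncurry (n := n) hM k
  have hlaw := (indepFun_iff_map_prod_eq_prod_map_map (hA n).measurable.aemeasurable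
    (hu_meas n).aemeasurable).mp (hu_indep n).symm
  have hpair : Measurable fun ω => (A n ω, u n ω) := (hA n).measurable.prodMk (hu_meas n)
  have : IsProbabilityMeasure ((P n).map (A n)) :=
    Measure.isProbabilityMeasure_map (hA n).measurable.aemeasurable
  have : IsProbabilityMeasure ((P n).map (u n)) :=
    Measure.isProbabilityMeasure_map (hu_meas n).aemeasurable
  have hfix : ∀ v : Fin n → ℝ, Integrable (fun B => ampError f v k B) ((P n).map (A n)) ∧
      ∫ B, ampError f v k B ∂(P n).map (A n) ≤ C / n := by
    intro v
    have hm : Measurable fun B : Fin n → Fin n → ℝ => ampError f v k B :=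
      Measurable.comp (g := fun p : (Fin n → Fin n → ℝ) × (Fin n → ℝ) => ampError f p.2 k p.1)
        (f := fun B => (B, v)) hmeas (measurable_id.prodMk measurable_const)
    rw [integral_map (hA n).measurable.aemeasurable hm.aestronglyMeasurable,
      integrable_map_measure hm.aestronglyMeasurable (hA n).measurable.aemeasurable]
    exact h hn (hA n) hM v
  have hprod : Integrable (fun p : (Fin n → Fin n → ℝ) × (Fin n → ℝ) => ampError f p.2 k p.1)
      (((P n).map (A n)).prod ((P n).map (u n))) := by
    rw [integrable_prod_iff' hmeas.aestronglyMeasurable]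
    refine ⟨Filter.Eventually.of_forall fun v => (hfix v).1, ?_⟩
    refine Integrable.of_bound ?_ (C / n) (Filter.Eventually.of_forall fun v => ?_)
    · exact (hmeas.norm.stronglyMeasurable.integral_prod_left').aestronglyMeasurable
    · simp only [Real.norm_eq_abs, abs_of_nonneg (ampError_nonneg _ _ _)]
      rw [abs_of_nonneg (integral_nonneg fun B => ampError_nonneg _ _ _)]
      exact (hfix v).2
  rw [← hlaw] at hprod
  refine ⟨(integrable_map_measure hmeas.aestronglyMeasurable hpair.aemeasurable).mp hprod, ?_⟩
  have e := integral_map hpair.aemeasurable (μ := P n) hmeas.aestronglyMeasurable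
  rw [← e, hlaw]
  rw [hlaw] at hprod
  rw [integral_prod_symm _ hprod]
  calc _ ≤ ∫ _ : Fin n → ℝ, C / n ∂(P n).map (u n) :=
        integral_mono hprod.integral_prod_right (integrable_const _) fun v => (hfix v).2
    _ = C / n := by simp
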